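/- Let $\Omega=\{x_1,\dots,x_n\}$ be a set of $n$ distinct real points, $p\in\mathbb N=\{0,1,2,\dots\}$ and $\alpha>0$. Let $f$ be a real function, analytic in a neighbourhood of $0$, such that the stationary kernel $\kappa(x,y)=f(|x-y|)$ on $\mathbb R\times\mathbb R$ is positive definite (all matrices $[\kappa(y_i,y_j)]_{i,j}$ are positive semi-definite). Put $f_i=f^{(i)}(0)/i!$ and let $r=\min\{k\ge 1: f_{2k-1}\ne 0\}\in\{1,2,\dots\}\cup\{\infty\}$ be the smoothness order; if $r=\infty$, assume moreover that $\kappa$ is strictly positive definite (the matrices at pairwise distinct points $y_i$ are positive definite). Notation. $L_\varepsilon=[f(\varepsilon|x_i-x_j|)]_{i,j=1}^n$; $D^{(q)}=[|x_i-x_j|^q]_{i,j=1}^n$; $V_{\le k}=[x_i^{j}]_{1\le i\le n,\,0\le j\le k}$ (with no column if $k=-1$); $v_{l+1}=(x_1^{l},\dots,x_n^{l})^\top$; $W_{\le k}=\big[\kappa^{(i,j)}(0,0)/(i!\,j!)\big]_{0\le i,j\le k}$, where $\kappa^{(i,j)}=\partial_x^i\partial_y^j\kappa$. For a subset $X$,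 $M_X$ denotes the principal submatrix indexed by $X$ and $V_{X,:}$ the rows of $V$ indexed by $X$; empty determinants are $1$. For $L$ positive semi-definite, $DPP(L)$ is the random subset $\mathcal X\subseteq\Omega$ with $\mathbb P(\mathcal X=X)=\det L_X/\sum_Y\det L_Y$, and $|DPP|_m(L)$ is the one with $\mathbb P(\mathcal X=X)=\det L_X/\sum_{|Y|=m}\det L_Y$ if $|X|=m$ and $0$ otherwise. A nonnegative pair $(L;V)$ consists of a symmetric $L\in\mathbb R^{n\times n}$ and $V\in\mathbb R^{n\times q}$ of full column rank such that $u^\top Lu\ge 0$ whenever $V^\top u=0$; then $DPP(L;V)$ is the random subset with $$\mathbb P(\mathcal X=X)\ \propto\ (-1)^q\det\begin{pmatrix}L_X&V_{X,:}\\ V_{X,:}^\top&0\end{pmatrix}.$$ Let $\mathcal X_\varepsilon\sim DPP(\alpha\varepsilon^{-p}L_\varepsilon)$ for $\varepsilon>0$. Then, as $\varepsilon\to0^+$, $\mathcal X_\varepsilon$ converges in law (that is, $\mathbb P(\mathcal X_\varepsilon=X)\to\mathbb P(\mathcal X_\star=X)$ for every $X\subseteq\Omega$) to the random subset $\mathcal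 X_\star$ described as follows. * If $\frac{p+1}2\ge n$, then for every value of $r$, $\mathcal X_\star=\Omega$ with probability one. * If $\frac{p+1}2\le n$: 1. if $r<\frac{p+1}2$, then $\mathcal X_\star=\Omega$ with probability one; 2. if $r>\frac{p+1}2$ and (a) $p$ is odd, then $\mathcal X_\star\sim|DPP|_l\big(V_{\le l-1}V_{\le l-1}^\top\big)$ with $l=\frac{p+1}2$; (b) $p$ is even, then, with $l=\frac p2$, the matrix $W_{\le l}$ is invertible, $\tilde w=\big((W_{\le l})^{-1}\big)_{l+1,l+1}>0$, the pair $\big(\tfrac{\alpha}{\tilde w}v_{l+1}v_{l+1}^\top;V_{\le l-1}\big)$ is nonnegative, and $\mathcal X_\star\sim DPP\big(\tfrac{\alpha}{\tilde w}v_{l+1}v_{l+1}^\top;V_{\le l-1}\big)$; 3. if $r=\frac{p+1}2$, then the pair $\big(\alpha f_{2r-1}D^{(2r-1)};V_{\le r-1}\big)$ is nonnegative and $\mathcal X_\star\sim DPP\big(\alpha f_{2r-1}D^{(2r-1)};V_{\le r-1}\big)$. -/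

import Mathlib

open Filter Topology
open scoped Matrix Nat

noncomputable section

namespace FlatLimit

/-! ### Stationary kernels on the real line -/

/-- The stationary kernel `κ(x, y) = f(|x - y|)` on `ℝ × ℝ`. -/
def stationaryKernel (f : ℝ → ℝ) : ℝ → ℝ → ℝ := fun x y => f |x - y|

/-- Positive definiteness of a kernel in the usual weak sense: every kernel matrix is
positive semi-definite. -/
def IsPosDefKernel (κ : ℝ → ℝ → ℝ) : Prop :=
  ∀ (m : ℕ) (y : Fin m → ℝ), (Matrix.of fun i j => κ (y i) (y j)).PosSemidef

/-- Strict positive definiteness of a kernel: every kernel matrix at pairwise distinct points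
is positive definite. -/
def IsStrictPosDefKernel (κ : ℝ → ℝ → ℝ) : Prop :=
  ∀ (m : ℕ) (y : Fin m → ℝ), Function.Injective y →
    (Matrix.of fun i j => κ (y i) (y j)).PosDef

/-- The rescaled derivative `f_i = f⁽ⁱ⁾(0) / i!`. -/
def taylorCoeff (f : ℝ → ℝ) (i : ℕ) : ℝ := iteratedDeriv i f 0 / (i ! : ℝ)

/-- The smoothness order: the least `r ≥ 1` with `f_{2r-1} ≠ 0`, and `∞` if there is none. -/
def smoothnessOrder (f : ℝ → ℝ) : ℕ∞ :=
  ⨅ (k : ℕ) (_ : 1 ≤ k ∧ taylorCoeff f (2 * k - 1) ≠ 0), (k : ℕ∞)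

/-- The Wronskian `W_{≤ k}`, with entries `κ^{(i,j)}(0,0) / (i! j!)` for `0 ≤ i, j ≤ k`. -/
def wronskian (κ : ℝ → ℝ → ℝ) (k : ℕ) : Matrix (Fin (k + 1)) (Fin (k + 1)) ℝ :=
  Matrix.of fun i j =>
    iteratedDeriv (i : ℕ) (fun s => iteratedDeriv (j : ℕ) (fun t => κ s t) 0) 0 /
      (((i : ℕ) ! : ℝ) * ((j : ℕ) ! : ℝ))

section Points

variable {n : ℕ}

/-- The kernel matrix `L_ε = [f(ε |x_i - x_j|)]_{i,j}`. -/
def kernelMatrix (f : ℝ → ℝ) (x : Fin n → ℝ) (ε : ℝ) : Matrix (Fin n) (Fin n) ℝ :=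
  Matrix.of fun i j => f (ε * |x i - x j|)

/-- The matrix `D^{(q)} = [|x_i - x_j|^q]_{i,j}`. -/
def distMatrix (x : Fin n → ℝ) (q : ℕ) : Matrix (Fin n) (Fin n) ℝ :=
  Matrix.of fun i j => |x i - x j| ^ q

/-- The Vandermonde matrix `V_{≤ c - 1} = V_{< c}`, whose `c` columns are the values of the
monomials `1, t, …, t^{c-1}` at the points (no column if `c = 0`). -/
def vanderLT (x : Fin n → ℝ) (c : ℕ) : Matrix (Fin n) (Fin c) ℝ :=
  Matrix.of fun i j => x i ^ (j : ℕ)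

/-- The vector `(x_1^q, …, x_n^q)`, that is, the column of index `q + 1` (counted from `1`)
of the Vandermonde matrices. -/
def vanderCol (x : Fin n → ℝ) (q : ℕ) : Fin n → ℝ := fun i => x i ^ q

/-! ### Laws of finite point processes

A point process on the ground set is a random subset of `Fin n` (the indices of the points);
its law is given by the probabilities of the subsets. -/

/-- The principal submatrix `L_X`. -/
def restrict (L : Matrix (Fin n) (Fin n) ℝ) (X : Finset (Fin n)) : Matrix X X ℝ :=
  L.submatrix Subtype.val Subtype.val

/-- The matrix `V_{X,:}` of the rows of `V` with index in `X`. -/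
def restrictRows {p : ℕ} (V : Matrix (Fin n) (Fin p) ℝ) (X : Finset (Fin n)) :
    Matrix X (Fin p) ℝ :=
  V.submatrix Subtype.val id

/-- The law of the L-ensemble `DPP(L)`. -/
def lEnsemble (L : Matrix (Fin n) (Fin n) ℝ) (X : Finset (Fin n)) : ℝ :=
  (restrict L X).det / ∑ Y : Finset (Fin n), (restrict L Y).det

/-- The law of the fixed-size L-ensemble `|DPP|_m(L)`. -/
def fixedSizeLEnsemble (m : ℕ) (L : Matrix (Fin n) (Fin n) ℝ) (X : Finset (Fin n)) : ℝ :=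
  if X.card = m then
    (restrict L X).det / ∑ Y : Finset (Fin n) with Y.card = m, (restrict L Y).det
  else 0

/-- `(L; V)` is a nonnegative pair: `L` is symmetric and conditionally positive semi-definite
with respect to `V`, and `V` has full column rank. -/
structure IsNonnegPair {p : ℕ} (L : Matrix (Fin n) (Fin n) ℝ) (V : Matrix (Fin n) (Fin p) ℝ) :
    Prop where
  symm : L.IsSymm
  cpsd : ∀ u : Fin n → ℝ, Vᵀ *ᵥ u = 0 → 0 ≤ u ⬝ᵥ (L *ᵥ u)
  fullRank : V.rank = p

/-- The unnormalised weight `(-1)^p det [[L_X, V_{X,:}], [V_{X,:}ᵀ, 0]]`. -/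
def extendedWeight {p : ℕ} (L : Matrix (Fin n) (Fin n) ℝ) (V : Matrix (Fin n) (Fin p) ℝ)
    (X : Finset (Fin n)) : ℝ :=
  (-1) ^ p *
    (Matrix.fromBlocks (restrict L X) (restrictRows V X) (restrictRows V X)ᵀ 0).det

/-- The law of the extended L-ensemble (partial-projection DPP) `DPP(L; V)`. -/
def extendedLEnsemble {p : ℕ} (L : Matrix (Fin n) (Fin n) ℝ) (V : Matrix (Fin n) (Fin p) ℝ)
    (X : Finset (Fin n)) : ℝ :=
  extendedWeight L V X / ∑ Y : Finset (Fin n), extendedWeight L V Y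

/-- The law of the deterministic process equal to the whole ground set. -/
def wholeSet (X : Finset (Fin n)) : ℝ := if X = Finset.univ then 1 else 0

/-- Convergence in law as `ε → 0`, `ε > 0`, of point processes on a finite ground set. -/
def ConvergesTo (P : ℝ → Finset (Fin n) → ℝ) (Q : Finset (Fin n) → ℝ) : Prop :=
  ∀ X : Finset (Fin n), Tendsto (fun ε => P ε X) (𝓝[>] 0) (𝓝 (Q X))

/-- The law of `X_ε ∼ DPP(α ε^{-p} L_ε)`, as a function of `ε`. -/
def rescaledLaw (f : ℝ → ℝ) (x : Fin n → ℝ) (α : ℝ) (p : ℕ) : ℝ → Finset (Fin n) → ℝ :=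
  fun ε => lEnsemble ((α * ε ^ (-(p : ℤ))) • kernelMatrix f x ε)

end Points

end FlatLimit

end

namespace FlatLimit

/-! ### Taylor expansion -/

/-! Put `ε = t ^ 2`, and let `c` be the smoothness order (any large integer if that order is
infinite). For `m` distinct points, the rows `T_a` of the inverse Vandermonde matrix are the
functionals dual to the monomials; `T_a` annihilates every degree below `a`. Expand `f (t ^ 2 * |y i
- y j|)` in its Taylor series and evaluate it on a pair `(T_a, T_b)`. Even powers of the distance
are polynomials and contribute only from degree `a + b` on. Odd powers are absent before degree `2 *
c - 1`. Hence `T_a` has weight `t ^ growthExp c a`, with `growthExp c a = min (2 * a) (2 * c - 1)`.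
After rescaling, the kernel matrix tends to a block diagonal matrix: a Wronskian on the indices
below `c`, and the form of `f_{2c-1} D^(2c-1)` on the others (`tendsto_bilin`,
`tendsto_det_kernelMatrix`). Working with `√ε` gives each functional an integer weight.

A set of `m` points therefore has weight of order `t` to the power `2 * weightExp c p m`, where
`weightExp c p m` is the sum of `growthExp c a - p` over `a < m`. Only the sizes minimising this
exponent survive. The comparison of `p` with `growthExp` gives the cases of the theorem: the full
size, the single size `l`, the tied sizes `l` and `l + 1`, or all sizes from `c` on.

For the leading terms to decide, they must not vanish. Both limit blocks are positive semidefinite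
as limits of kernel forms, and Cauchy–Schwarz makes them definite. A null vector of the distance
block would make a combination of the nonsmooth functions `|y i - s| ^ (2 * c - 1)` polynomial in
`s` (`eq_zero_of_sum_sum_dist_eq_zero`). A null vector of the Wronskian would make `f` solve a
linear differential equation, contradicting `f_{2c-1} ≠ 0` or strict positive definiteness
(`eq_zero_of_wronskian_quadratic_eq_zero`).

The limits are extended L-ensembles because, in the dual basis, the bordered determinant reduces to
the same lower block (`det_fromBlocks_vanderLT`). -/

theorem isBigO_sub_taylor {f : ℝ → ℝ} (hf : AnalyticAt ℝ f 0) (N : ℕ) :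
    (fun s => f s - ∑ k ∈ Finset.range N, taylorCoeff f k * s ^ k) =O[𝓝 0] fun s => s ^ N := by
  have h := hf.hasFPowerSeriesAt.isBigO_sub_partialSum_pow N
  simp only [zero_add, FormalMultilinearSeries.partialSum,
    FormalMultilinearSeries.ofScalars_apply_eq, smul_eq_mul] at h
  refine h.trans (Asymptotics.IsBigO.of_bound 1 ?_)
  filter_upwards with s
  simp

/-- The remainder of the Taylor expansion of `f` at `0` to order `N`. -/
noncomputable def taylorRem (f : ℝ → ℝ) (N : ℕ) (s : ℝ) : ℝ :=
  f s - ∑ k ∈ Finset.range N, taylorCoeff f k * s ^ k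

theorem eq_taylor_add_rem (f : ℝ → ℝ) (N : ℕ) (s : ℝ) :
    f s = ∑ k ∈ Finset.range N, taylorCoeff f k * s ^ k + taylorRem f N s := by
  simp [taylorRem]

theorem tendsto_taylorRem_div {f : ℝ → ℝ} (hf : AnalyticAt ℝ f 0) {N q E : ℕ} (hq : q ≠ 0)
    (hE : E < q * N) (d : ℝ) :
    Tendsto (fun t => taylorRem f N (t ^ q * d) / t ^ E) (𝓝[>] 0) (𝓝 0) := by
  have h0 : Tendsto (fun t : ℝ => t ^ q * d) (𝓝[>] 0) (𝓝 0) := by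
    have : Continuous fun t : ℝ => t ^ q * d := by fun_prop
    have h := this.tendsto 0
    simp only [zero_pow hq, zero_mul] at h
    exact h.mono_left nhdsWithin_le_nhds
  have h1 : (fun t : ℝ => taylorRem f N (t ^ q * d)) =O[𝓝[>] 0] fun t => t ^ (q * N) := by
    refine ((isBigO_sub_taylor hf N).comp_tendsto h0).trans ?_
    refine Asymptotics.IsBigO.of_bound (|d| ^ N) ?_
    filter_upwards with t
    simp only [Function.comp_apply, Real.norm_eq_abs, abs_mul, abs_pow, mul_pow, pow_mul]
    rw [mul_comm]
  exact (h1.trans_isLittleO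
    ((Asymptotics.isLittleO_pow_pow hE).mono nhdsWithin_le_nhds)).tendsto_div_nhds_zero

theorem tendsto_pow_div_pow {E K : ℕ} (h : E ≤ K) :
    Tendsto (fun t : ℝ => t ^ K / t ^ E) (𝓝[>] 0) (𝓝 (if K = E then 1 else 0)) := by
  obtain ⟨d, rfl⟩ := Nat.exists_eq_add_of_le h
  have h1 : (fun t : ℝ => t ^ d) =ᶠ[𝓝[>] 0] fun t : ℝ => t ^ (E + d) / t ^ E := by
    filter_upwards [self_mem_nhdsWithin] with t ht
    have : t ≠ 0 := ne_of_gt ht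
    rw [pow_add]
    field_simp
  refine Tendsto.congr' h1 ?_
  have h2 := ((continuous_pow d).tendsto (0 : ℝ)).mono_left
    (nhdsWithin_le_nhds (s := Set.Ioi (0 : ℝ)))
  by_cases hd : d = 0
  · subst hd; simp
  · simpa [hd] using h2

/-- A functional on the points `y` that annihilates the monomials of degree less than `a` acts on
the dilations of an analytic function as the `a`-th Taylor coefficient does. -/
theorem tendsto_sum_dilate_div {ι : Type*} [Fintype ι] {g : ℝ → ℝ} (hg : AnalyticAt ℝ g 0)
    (y u : ι → ℝ) (q : ℕ) (hq : q ≠ 0) (a : ℕ) (hu : ∀ j < a, ∑ i, u i * y i ^ j = 0) :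
    Tendsto (fun t : ℝ => (∑ i, u i * g (t ^ q * y i)) / t ^ (q * a)) (𝓝[>] 0)
      (𝓝 (taylorCoeff g a * ∑ i, u i * y i ^ a)) := by
  have key : ∀ t : ℝ, 0 < t → (∑ i, u i * g (t ^ q * y i)) / t ^ (q * a) =
      taylorCoeff g a * (∑ i, u i * y i ^ a) +
        ∑ i, u i * (taylorRem g (a + 1) (t ^ q * y i) / t ^ (q * a)) := by
    intro t ht
    have h1 : ∑ i, u i * g (t ^ q * y i) =
        (∑ k ∈ Finset.range (a + 1), taylorCoeff g k * t ^ (q * k) * ∑ i, u i * y i ^ k) +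
          ∑ i, u i * taylorRem g (a + 1) (t ^ q * y i) := by
      simp_rw [Finset.mul_sum]
      rw [Finset.sum_comm, ← Finset.sum_add_distrib]
      refine Finset.sum_congr rfl fun i _ => ?_
      rw [eq_taylor_add_rem g (a + 1), mul_add, Finset.mul_sum]
      congr 1
      refine Finset.sum_congr rfl fun k _ => ?_
      rw [mul_pow, ← pow_mul]; ring
    have h2 : (∑ k ∈ Finset.range (a + 1), taylorCoeff g k * t ^ (q * k) * ∑ i, u i * y i ^ k) =
        taylorCoeff g a * t ^ (q * a) * ∑ i, u i * y i ^ a := by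
      rw [Finset.sum_range_succ, Finset.sum_eq_zero, zero_add]
      intro k hk
      rw [hu k (Finset.mem_range.1 hk), mul_zero]
    have ht' : t ^ (q * a) ≠ 0 := (pow_pos ht _).ne'
    rw [h1, h2, add_div, Finset.sum_div]
    congr 1
    · field_simp
    · simp_rw [mul_div_assoc]
  have h3 : Tendsto (fun t : ℝ => taylorCoeff g a * (∑ i, u i * y i ^ a) +
        ∑ i, u i * (taylorRem g (a + 1) (t ^ q * y i) / t ^ (q * a))) (𝓝[>] 0)
      (𝓝 (taylorCoeff g a * (∑ i, u i * y i ^ a) + ∑ i, u i * 0)) := by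
    refine tendsto_const_nhds.add (tendsto_finsetSum _ fun i _ => Tendsto.const_mul _ ?_)
    exact tendsto_taylorRem_div hg hq (Nat.mul_lt_mul_of_pos_left a.lt_succ_self (by omega)) _
  simp only [mul_zero, Finset.sum_const_zero, add_zero] at h3
  refine h3.congr' ?_
  filter_upwards [self_mem_nhdsWithin] with t ht
  exact (key t ht).symm

/-! ### Bilinear forms of the kernel matrices in the flat limit -/

/-- The order, in powers of `√ε`, of the functionals of index `a` in the flat limit. -/
def growthExp (c a : ℕ) : ℕ := min (2 * a) (2 * c - 1)

/-- The `(a, b)` entry of the Wronskian of a stationary kernel, in terms of `f`. -/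
noncomputable def wronskianEntry (f : ℝ → ℝ) (a b : ℕ) : ℝ :=
  (-1) ^ b * ((a + b).choose a : ℝ) * taylorCoeff f (a + b)

section Bilinear

variable {ι : Type*} [Fintype ι]

theorem sum_sum_abs_sub_pow_of_even (y u v : ι → ℝ) {k : ℕ} (hk : Even k) :
    ∑ i, ∑ j, u i * v j * |y i - y j| ^ k =
      ∑ m ∈ Finset.range (k + 1), (-1) ^ (k - m) * (k.choose m : ℝ) *
        ((∑ i, u i * y i ^ m) * ∑ j, v j * y j ^ (k - m)) := by
  simp_rw [hk.pow_abs, sub_eq_add_neg, add_pow, Finset.sum_mul_sum, Finset.mul_sum]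
  rw [Finset.sum_comm' (t' := Finset.univ) (s' := fun _ => Finset.range (k + 1)) (by simp)]
  refine Finset.sum_congr rfl fun i _ => ?_
  rw [Finset.sum_comm' (t' := Finset.univ) (s' := fun _ => Finset.range (k + 1)) (by simp)]
  refine Finset.sum_congr rfl fun j _ => Finset.sum_congr rfl fun m _ => ?_
  rw [neg_pow]; ring

variable {y u v : ι → ℝ} {a b : ℕ}

/-- Each binomial term of total degree below `a + b` contains a moment of `u` of order below `a` or
a moment of `v` of order below `b`. -/
theorem sum_sum_abs_sub_pow_eq_zero (hu : ∀ j < a, ∑ i, u i * y i ^ j = 0)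
    (hv : ∀ j < b, ∑ i, v i * y i ^ j = 0) {k : ℕ} (hk : Even k) (hkab : k < a + b) :
    ∑ i, ∑ j, u i * v j * |y i - y j| ^ k = 0 := by
  rw [sum_sum_abs_sub_pow_of_even y u v hk]
  refine Finset.sum_eq_zero fun m hm' => ?_
  rw [Finset.mem_range] at hm'
  rcases lt_or_ge m a with h | h
  · rw [hu m h]; simp
  · rw [hv (k - m) (by omega)]; simp

theorem sum_sum_abs_sub_pow_add (hu : ∀ j < a, ∑ i, u i * y i ^ j = 0)
    (hv : ∀ j < b, ∑ i, v i * y i ^ j = 0) (hk : Even (a + b)) :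
    ∑ i, ∑ j, u i * v j * |y i - y j| ^ (a + b) =
      (-1) ^ b * ((a + b).choose a : ℝ) * ((∑ i, u i * y i ^ a) * ∑ j, v j * y j ^ b) := by
  rw [sum_sum_abs_sub_pow_of_even y u v hk, Finset.sum_eq_single a]
  · simp
  · intro m hm' hm
    rw [Finset.mem_range] at hm'
    rcases lt_or_ge m a with h | h
    · rw [hu m h]; simp
    · rw [hv (a + b - m) (by omega)]; simp
  · intro h; simp at h

/-- The competing orders in `t` are `2 * (a + b)`, from even powers, and `2 * (2 * c - 1)`, from the
first odd power. The former attains `growthExp c a + growthExp c b` exactly when both indices are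
below `c`, the latter exactly when both are at least `c`. In the mixed case both orders are strictly
larger, so the limit decouples. -/
theorem tendsto_bilin {f : ℝ → ℝ} (hf : AnalyticAt ℝ f 0) {c : ℕ} (hc : 1 ≤ c)
    (hodd : ∀ k, 1 ≤ k → k < c → taylorCoeff f (2 * k - 1) = 0)
    (hu : ∀ j < a, ∑ i, u i * y i ^ j = 0) (hv : ∀ j < b, ∑ i, v i * y i ^ j = 0) :
    Tendsto (fun t : ℝ => (∑ i, ∑ j, u i * v j * f (t ^ 2 * |y i - y j|)) /
        t ^ (growthExp c a + growthExp c b)) (𝓝[>] 0)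
      (𝓝 ((if a < c ∧ b < c then
            wronskianEntry f a b * ((∑ i, u i * y i ^ a) * ∑ j, v j * y j ^ b) else 0) +
          if c ≤ a ∧ c ≤ b then
            taylorCoeff f (2 * c - 1) * ∑ i, ∑ j, u i * v j * |y i - y j| ^ (2 * c - 1)
          else 0)) := by
  set E := growthExp c a + growthExp c b with hE
  set G : ℕ → ℝ := fun k => ∑ i, ∑ j, u i * v j * |y i - y j| ^ k with hG
  set A : ℝ := if a < c ∧ b < c then
            wronskianEntry f a b * ((∑ i, u i * y i ^ a) * ∑ j, v j * y j ^ b) else 0 with hA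
  set B : ℝ := if c ≤ a ∧ c ≤ b then taylorCoeff f (2 * c - 1) * G (2 * c - 1) else 0 with hB
  have hEle : E < 2 * (2 * c) := by simp only [hE, growthExp]; omega
  have hterm : ∀ k ∈ Finset.range (2 * c),
      Tendsto (fun t : ℝ => taylorCoeff f k * G k * (t ^ (2 * k) / t ^ E)) (𝓝[>] 0)
        (𝓝 ((if k = a + b then A else 0) + if k = 2 * c - 1 then B else 0)) := by
    intro k hk
    rw [Finset.mem_range] at hk
    rcases Nat.even_or_odd k with hev | hod
    · rw [if_neg (show k ≠ 2 * c - 1 by obtain ⟨q, rfl⟩ := hev; omega), add_zero]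
      rcases lt_trichotomy k (a + b) with h | h | h
      · simp [hG, sum_sum_abs_sub_pow_eq_zero hu hv hev h, h.ne]
      · subst h
        rw [if_pos rfl]
        have := (tendsto_pow_div_pow (E := E) (K := 2 * (a + b))
          (by simp only [hE, growthExp]; omega)).const_mul (taylorCoeff f (a + b) * G (a + b))
        convert this using 2
        simp only [hA, hG, sum_sum_abs_sub_pow_add hu hv hev, wronskianEntry]
        by_cases hab : a < c ∧ b < c
        · rw [if_pos hab, if_pos (by simp only [hE, growthExp]; omega)]; ring
        · rw [if_neg hab, if_neg (by simp only [hE, growthExp]; omega)]; ring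
      · rw [if_neg h.ne']
        have := (tendsto_pow_div_pow (E := E) (K := 2 * k)
          (by simp only [hE, growthExp]; omega)).const_mul (taylorCoeff f k * G k)
        rwa [if_neg (by simp only [hE, growthExp]; omega), mul_zero] at this
    · obtain ⟨q, rfl⟩ := hod
      rcases Nat.lt_or_ge (q + 1) c with h | h
      · have h0 : taylorCoeff f (2 * q + 1) = 0 := hodd (q + 1) (by omega) h
        rw [if_neg (show 2 * q + 1 ≠ 2 * c - 1 by omega)]
        have : (if 2 * q + 1 = a + b then A else 0) = 0 := by
          split_ifs with h1
          · simp [hA, wronskianEntry, ← h1, h0]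
          · rfl
        simp [h0, this]
      · have hqc : 2 * q + 1 = 2 * c - 1 := by omega
        rw [if_pos hqc]
        have : (if 2 * q + 1 = a + b then A else 0) = 0 := by
          split_ifs with h1
          · rw [hA, if_neg (by omega)]
          · rfl
        rw [this, zero_add, hqc]
        have := (tendsto_pow_div_pow (E := E) (K := 2 * (2 * c - 1))
          (by simp only [hE, growthExp]; omega)).const_mul
          (taylorCoeff f (2 * c - 1) * G (2 * c - 1))
        convert this using 2
        by_cases hab : c ≤ a ∧ c ≤ b
        · rw [hB, if_pos hab, if_pos (by simp only [hE, growthExp]; omega), mul_one]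
        · rw [hB, if_neg hab, if_neg (by simp only [hE, growthExp]; omega), mul_zero]
  have hsum : ∑ k ∈ Finset.range (2 * c),
      ((if k = a + b then A else 0) + if k = 2 * c - 1 then B else 0) = A + B := by
    rw [Finset.sum_add_distrib, Finset.sum_ite_eq', Finset.sum_ite_eq',
      if_pos (Finset.mem_range.2 (by omega : 2 * c - 1 < 2 * c))]
    congr 1
    split_ifs with h
    · rfl
    · rw [hA, if_neg]; rw [Finset.mem_range] at h; omega
  have hlim : Tendsto (fun t : ℝ =>
      (∑ k ∈ Finset.range (2 * c), taylorCoeff f k * G k * (t ^ (2 * k) / t ^ E)) +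
        ∑ i, ∑ j, u i * v j * (taylorRem f (2 * c) (t ^ 2 * |y i - y j|) / t ^ E)) (𝓝[>] 0)
      (𝓝 ((A + B) + ∑ i, ∑ j, u i * v j * 0)) := by
    rw [← hsum]
    refine (tendsto_finsetSum _ hterm).add (tendsto_finsetSum _ fun i _ =>
      tendsto_finsetSum _ fun j _ => Tendsto.const_mul _ ?_)
    exact tendsto_taylorRem_div hf two_ne_zero hEle _
  simp only [mul_zero, Finset.sum_const_zero, add_zero] at hlim
  refine hlim.congr fun t => ?_
  have h1 : ∀ s, f s = ∑ k ∈ Finset.range (2 * c), taylorCoeff f k * s ^ k +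
    taylorRem f (2 * c) s := eq_taylor_add_rem f (2 * c)
  simp only [hG, Finset.mul_sum, Finset.sum_mul, Finset.sum_div]
  rw [Finset.sum_comm, ← Finset.sum_add_distrib]
  refine Finset.sum_congr rfl fun i _ => ?_
  rw [Finset.sum_comm, ← Finset.sum_add_distrib]
  refine Finset.sum_congr rfl fun j _ => ?_
  rw [h1 (t ^ 2 * |y i - y j|), mul_add, add_div, Finset.mul_sum, Finset.sum_div, mul_div_assoc]
  congr 1
  refine Finset.sum_congr rfl fun k _ => ?_
  rw [mul_pow, ← pow_mul]; ring

end Bilinear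

/-! ### Positivity of the flat limit -/

theorem IsPosDefKernel.sum_sum_nonneg {K : ℝ → ℝ → ℝ} (h : IsPosDefKernel K) {ι : Type*}
    [Fintype ι] (y w : ι → ℝ) : 0 ≤ ∑ i, ∑ j, w i * w j * K (y i) (y j) := by
  let e := Fintype.equivFin ι
  have h1 := (Matrix.posSemidef_iff_dotProduct_mulVec.1
    (h (Fintype.card ι) (y ∘ e.symm))).2 (w ∘ e.symm)
  simp only [dotProduct, Matrix.mulVec, Matrix.of_apply, Function.comp_apply, Finset.mul_sum,
    star_trivial] at h1
  rw [← e.symm.sum_comp]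
  refine h1.trans_eq (Finset.sum_congr rfl fun i _ => ?_)
  rw [← e.symm.sum_comp]
  exact Finset.sum_congr rfl fun j _ => by ring

/-- The Cauchy–Schwarz argument in scalar form: `z` is the multiple of a test functional added to an
isotropic one, and `b` is their cross term. -/
theorem eq_zero_of_quadratic_nonneg {b d : ℝ} (h : ∀ z : ℝ, 0 ≤ z ^ 2 * d + 2 * z * b) : b = 0 := by
  have h1 := discrim_le_zero (a := d) (b := 2 * b) (c := 0) fun z => by
    have := h z; nlinarith
  simp only [discrim] at h1
  nlinarith [sq_nonneg b]

section Conditional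

variable {f : ℝ → ℝ} (hf : AnalyticAt ℝ f 0) (hpd : IsPosDefKernel (stationaryKernel f)) {c : ℕ}
  (hc : 1 ≤ c) (hodd : ∀ k, 1 ≤ k → k < c → taylorCoeff f (2 * k - 1) = 0)
  {ι : Type*} [Fintype ι] {y u : ι → ℝ}

theorem kernel_dilate_nonneg {f : ℝ → ℝ} (hpd : IsPosDefKernel (stationaryKernel f))
    (y u : ι → ℝ) (t : ℝ) : 0 ≤ ∑ i, ∑ j, u i * u j * f (t ^ 2 * |y i - y j|) := by
  refine (hpd.sum_sum_nonneg (fun i => t ^ 2 * y i) u).trans_eq ?_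
  refine Finset.sum_congr rfl fun i _ => Finset.sum_congr rfl fun j _ => ?_
  rw [stationaryKernel, ← mul_sub, abs_mul, abs_of_nonneg (sq_nonneg t)]

include hf hpd hc hodd in
theorem taylorCoeff_mul_sum_sum_dist_nonneg (hu : ∀ j < c, ∑ i, u i * y i ^ j = 0) :
    0 ≤ taylorCoeff f (2 * c - 1) * ∑ i, ∑ j, u i * u j * |y i - y j| ^ (2 * c - 1) := by
  have h := tendsto_bilin hf hc hodd hu hu
  rw [if_neg (by omega), if_pos (by omega), zero_add] at h
  refine ge_of_tendsto h ?_
  filter_upwards [self_mem_nhdsWithin] with t ht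
  have : 0 < t := ht
  exact div_nonneg (kernel_dilate_nonneg hpd y u t) (by positivity)

include hf hpd hc hodd in
-- Conditional positivity is applied to `u + r w` on the disjoint union of the two point systems.
-- Points may repeat in the nonnegativity statement, so the systems need not be disjoint in `ℝ`.
theorem taylorCoeff_mul_sum_sum_dist_cross {κ : Type*} [Fintype κ] {z w : κ → ℝ}
    (hu : ∀ j < c, ∑ i, u i * y i ^ j = 0) (hw : ∀ j < c, ∑ k, w k * z k ^ j = 0)
    (h0 : taylorCoeff f (2 * c - 1) * ∑ i, ∑ j, u i * u j * |y i - y j| ^ (2 * c - 1) = 0) :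
    taylorCoeff f (2 * c - 1) * ∑ i, ∑ k, u i * w k * |y i - z k| ^ (2 * c - 1) = 0 := by
  refine eq_zero_of_quadratic_nonneg
    (d := taylorCoeff f (2 * c - 1) * ∑ k, ∑ l, w k * w l * |z k - z l| ^ (2 * c - 1)) fun r => ?_
  have h := taylorCoeff_mul_sum_sum_dist_nonneg hf hpd hc hodd (ι := ι ⊕ κ) (y := Sum.elim y z)
    (u := Sum.elim u fun k => r * w k) (fun j hj => by
      simp only [Fintype.sum_sum_type, Sum.elim_inl, Sum.elim_inr, hu j hj, mul_assoc,
        ← Finset.mul_sum, hw j hj]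
      simp)
  simp only [Fintype.sum_sum_type, Sum.elim_inl, Sum.elim_inr, Finset.sum_add_distrib] at h
  have h1 : ∑ k, ∑ i, r * w k * u i * |z k - y i| ^ (2 * c - 1) =
      r * ∑ i, ∑ k, u i * w k * |y i - z k| ^ (2 * c - 1) := by
    rw [Finset.sum_comm, Finset.mul_sum]
    refine Finset.sum_congr rfl fun i _ => ?_
    rw [Finset.mul_sum]
    exact Finset.sum_congr rfl fun k _ => by rw [abs_sub_comm]; ring
  have h2 : ∑ i, ∑ k, u i * (r * w k) * |y i - z k| ^ (2 * c - 1) =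
      r * ∑ i, ∑ k, u i * w k * |y i - z k| ^ (2 * c - 1) := by
    rw [Finset.mul_sum]
    refine Finset.sum_congr rfl fun i _ => ?_
    rw [Finset.mul_sum]
    exact Finset.sum_congr rfl fun k _ => by ring
  have h3 : ∑ k, ∑ l, r * w k * (r * w l) * |z k - z l| ^ (2 * c - 1) =
      r ^ 2 * ∑ k, ∑ l, w k * w l * |z k - z l| ^ (2 * c - 1) := by
    rw [Finset.mul_sum]
    refine Finset.sum_congr rfl fun i _ => ?_
    rw [Finset.mul_sum]
    exact Finset.sum_congr rfl fun k _ => by ring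
  rw [h1, h2, h3, mul_add, mul_add, h0] at h
  nlinarith

theorem sum_lagrange_basis_mul_pow (c : ℕ) (s : ℝ) {k : ℕ} (hk : k < c) :
    ∑ j : Fin c, (Lagrange.basis Finset.univ (fun j : Fin c => (j : ℝ)) j).eval s * (j : ℝ) ^ k =
      s ^ k := by
  have hinj : Set.InjOn (fun j : Fin c => (j : ℝ)) (Finset.univ : Finset (Fin c)) := by
    intro i _ j _ h
    exact Fin.ext (Nat.cast_injective (R := ℝ) h)
  have h := congrArg (Polynomial.eval s) (Lagrange.eq_interpolate (f := Polynomial.X ^ k) hinj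
    (by rw [Polynomial.degree_X_pow]; simpa using hk))
  rw [Lagrange.interpolate_apply, Polynomial.eval_finsetSum] at h
  simp only [Polynomial.eval_pow, Polynomial.eval_X, Polynomial.eval_mul, Polynomial.eval_C] at h
  rw [h]
  exact Finset.sum_congr rfl fun j _ => mul_comm _ _

theorem analyticAt_abs_sub_pow {a b : ℝ} (h : a ≠ b) (q : ℕ) :
    AnalyticAt ℝ (fun s => |a - s| ^ q) b := by
  rcases lt_or_gt_of_ne h with h | h
  · have : AnalyticAt ℝ (fun s => (s - a) ^ q) b := by fun_prop
    refine this.congr ?_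
    filter_upwards [lt_mem_nhds h] with s hs
    rw [abs_sub_comm, abs_of_pos (by linarith)]
  · have : AnalyticAt ℝ (fun s => (a - s) ^ q) b := by fun_prop
    refine this.congr ?_
    filter_upwards [gt_mem_nhds h] with s hs
    rw [abs_of_pos (by linarith)]

/-- By the identity theorem, agreement with `r * (s - a) ^ q` to the right of `a` extends to the
left, where the odd power has the opposite sign. -/
theorem eq_zero_of_analyticAt_mul_abs_sub_pow {a r : ℝ} {q : ℕ} (hq : Odd q)
    (h : AnalyticAt ℝ (fun s => r * |a - s| ^ q) a) : r = 0 := by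
  have h1 : AnalyticAt ℝ (fun s => r * (s - a) ^ q) a := by fun_prop
  have h2 : ∀ᶠ s in 𝓝 a, r * |a - s| ^ q = r * (s - a) ^ q := by
    refine (h.frequently_eq_iff_eventually_eq h1).1 (Eventually.frequently ?_ |>.filter_mono
      (nhdsGT_le_nhdsNE a))
    filter_upwards [self_mem_nhdsWithin] with s hs
    rw [abs_sub_comm, abs_of_pos (sub_pos.2 hs)]
  have h3 : ∀ᶠ s in 𝓝[<] a, r * |a - s| ^ q = r * (s - a) ^ q ∧ s < a :=
    (h2.filter_mono nhdsWithin_le_nhds).and self_mem_nhdsWithin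
  obtain ⟨s, hs, hsa⟩ := h3.exists
  rw [abs_of_pos (by linarith), ← neg_sub s a, hq.neg_pow] at hs
  have h4 : (s - a) ^ q ≠ 0 := pow_ne_zero _ (by linarith)
  have h5 : r * (s - a) ^ q = 0 := by linarith
  exact (mul_eq_zero.1 h5).resolve_right h4

include hf hpd hc hodd in
/-- The conditional positivity of `(-1)^c |x - y|^(2c-1)` is strict. -/
theorem eq_zero_of_sum_sum_dist_eq_zero (hfc : taylorCoeff f (2 * c - 1) ≠ 0)
    (hy : Function.Injective y) (hu : ∀ j < c, ∑ i, u i * y i ^ j = 0)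
    (h0 : ∑ i, ∑ j, u i * u j * |y i - y j| ^ (2 * c - 1) = 0) : u = 0 := by
  classical
  let ℓ : Fin c → Polynomial ℝ := Lagrange.basis Finset.univ fun j : Fin c => (j : ℝ)
  let F : ℝ → ℝ := fun s => ∑ i, u i * |y i - s| ^ (2 * c - 1)
  have hF : ∀ s, F s = (∑ j : Fin c, Polynomial.C (F j) * ℓ j).eval s := by
    intro s
    -- The test functional is evaluation at `s` minus Lagrange interpolation at the nodes `0, …, c -
    -- 1`. It annihilates degrees below `c`, so orthogonality to it says that `F` equals its own
    -- interpolation polynomial.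
    have h := taylorCoeff_mul_sum_sum_dist_cross hf hpd hc hodd (κ := Option (Fin c))
      (z := fun o => o.elim s fun j => (j : ℝ)) (w := fun o => o.elim 1 fun j => -(ℓ j).eval s) hu
      (fun k hk => by
        simp only [Fintype.sum_option, Option.elim_none, Option.elim_some, neg_mul,
          Finset.sum_neg_distrib, ℓ, sum_lagrange_basis_mul_pow c s hk]
        ring) (by rw [h0, mul_zero])
    have h := (mul_eq_zero.1 h).resolve_left hfc
    simp only [Fintype.sum_option, Option.elim_none, Option.elim_some, Finset.sum_add_distrib,
      mul_one] at h
    rw [Finset.sum_comm] at h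
    rw [Polynomial.eval_finsetSum]
    simp only [Polynomial.eval_mul, Polynomial.eval_C, F, Finset.sum_mul]
    rw [← sub_eq_zero, sub_eq_add_neg, ← h, ← Finset.sum_neg_distrib]
    congr 1
    refine Finset.sum_congr rfl fun j _ => ?_
    rw [← Finset.sum_neg_distrib]
    exact Finset.sum_congr rfl fun i _ => by ring
  funext i
  refine eq_zero_of_analyticAt_mul_abs_sub_pow (a := y i) (q := 2 * c - 1)
    ⟨c - 1, by omega⟩ ?_
  -- Both the polynomial `F` and the terms with `k ≠ i` are analytic at `y i`, hence so is the
  -- remaining term `u i * |y i - s| ^ (2 * c - 1)`.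
  have h1 : AnalyticAt ℝ F (y i) := by
    rw [funext hF]
    exact AnalyticOnNhd.eval_polynomial _ _ (Set.mem_univ _)
  have h2 : AnalyticAt ℝ (fun s => ∑ k ∈ Finset.univ.erase i, u k * |y k - s| ^ (2 * c - 1))
      (y i) := by
    refine Finset.analyticAt_fun_sum _ fun k hk => analyticAt_const.mul ?_
    exact analyticAt_abs_sub_pow (hy.ne (Finset.ne_of_mem_erase hk)) _
  have h3 := h1.sub h2
  refine h3.congr (Eventually.of_forall fun s => ?_)
  simp only [F, Pi.sub_apply]
  rw [← Finset.add_sum_erase _ _ (Finset.mem_univ i)]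
  ring

end Conditional

/-! ### The functionals dual to the monomials -/

section Dual

variable {m : ℕ} {y : Fin m → ℝ}

theorem vandermonde_inv_mul (hy : Function.Injective y) :
    (Matrix.vandermonde y)⁻¹ * Matrix.vandermonde y = 1 :=
  Matrix.nonsing_inv_mul _ (isUnit_iff_ne_zero.2 (Matrix.det_vandermonde_ne_zero_iff.2 hy))

theorem sum_vandermonde_inv_mul_pow (hy : Function.Injective y) (a b : Fin m) :
    ∑ i, (Matrix.vandermonde y)⁻¹ a i * y i ^ (b : ℕ) = if a = b then 1 else 0 := by
  have h := congrFun (congrFun (vandermonde_inv_mul hy) a) b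
  rwa [Matrix.mul_apply, Matrix.one_apply] at h

theorem sum_vandermonde_inv_mul_pow_of_lt (hy : Function.Injective y) (a : Fin m) {j : ℕ}
    (hj : j < a) : ∑ i, (Matrix.vandermonde y)⁻¹ a i * y i ^ j = 0 := by
  have h := sum_vandermonde_inv_mul_pow hy a ⟨j, hj.trans a.2⟩
  rwa [if_neg (by rw [Fin.ext_iff]; exact hj.ne')] at h

theorem sum_vandermonde_inv_mul_pow_self (hy : Function.Injective y) (a : Fin m) :
    ∑ i, (Matrix.vandermonde y)⁻¹ a i * y i ^ (a : ℕ) = 1 := by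
  rw [sum_vandermonde_inv_mul_pow hy, if_pos rfl]

end Dual

/-! ### Positive definiteness of the Wronskian -/

theorem injective_fin_natCast (c : ℕ) : Function.Injective fun j : Fin c => (j : ℝ) :=
  fun _ _ h => Fin.ext (Nat.cast_injective (R := ℝ) h)

/-- The weights `∑ a, u a * T a i / t ^ (2 * a)` at the points `t ^ 2 * y i` are divided differences
approximating the operator `∑ a, u a * ∂^a / a!` at the origin. The Wronskian form is thus a limit
of kernel forms. -/
theorem tendsto_wronskian_quadratic {f : ℝ → ℝ} (hf : AnalyticAt ℝ f 0) {c : ℕ}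
    (hodd : ∀ k, 1 ≤ k → k < c → taylorCoeff f (2 * k - 1) = 0) {y : Fin c → ℝ}
    (hy : Function.Injective y) (u : Fin c → ℝ) :
    Tendsto (fun t : ℝ => ∑ i, ∑ j,
        (∑ a, u a * ((Matrix.vandermonde y)⁻¹ a i / t ^ (2 * (a : ℕ)))) *
        (∑ a, u a * ((Matrix.vandermonde y)⁻¹ a j / t ^ (2 * (a : ℕ)))) *
        f (t ^ 2 * |y i - y j|)) (𝓝[>] 0)
      (𝓝 (∑ a, ∑ b, u a * u b * wronskianEntry f a b)) := by
  set T := (Matrix.vandermonde y)⁻¹ with hT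
  have h : Tendsto (fun t : ℝ => ∑ a, ∑ b, u a * u b *
      ((∑ i, ∑ j, T a i * T b j * f (t ^ 2 * |y i - y j|)) /
        t ^ (growthExp c a + growthExp c b))) (𝓝[>] 0)
      (𝓝 (∑ a, ∑ b, u a * u b * wronskianEntry f a b)) := by
    refine tendsto_finsetSum _ fun a _ => tendsto_finsetSum _ fun b _ => Tendsto.const_mul _ ?_
    have h := tendsto_bilin hf (by have := a.2; omega) hodd
      (fun j => sum_vandermonde_inv_mul_pow_of_lt hy a (j := j))
      (fun j => sum_vandermonde_inv_mul_pow_of_lt hy b (j := j))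
    rwa [if_pos ⟨a.2, b.2⟩, if_neg (by have := a.2; omega), add_zero,
      sum_vandermonde_inv_mul_pow_self hy, sum_vandermonde_inv_mul_pow_self hy, mul_one,
      mul_one] at h
  refine h.congr fun t => ?_
  have hg : ∀ a : Fin c, growthExp c a = 2 * (a : ℕ) := fun a => by
    have := a.2
    simp only [growthExp]; omega
  simp only [hg, Finset.sum_mul, Finset.mul_sum, Finset.sum_div, pow_add]
  calc _ = ∑ a, ∑ i, ∑ j, ∑ b, u a * u b * (T a i * T b j * f (t ^ 2 * |y i - y j|) /
        (t ^ (2 * (a : ℕ)) * t ^ (2 * (b : ℕ)))) := by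
        refine Finset.sum_congr rfl fun a _ => ?_
        rw [Finset.sum_comm]
        refine Finset.sum_congr rfl fun i _ => ?_
        rw [Finset.sum_comm]
    _ = ∑ i, ∑ j, ∑ a, ∑ b, u a * u b * (T a i * T b j * f (t ^ 2 * |y i - y j|) /
        (t ^ (2 * (a : ℕ)) * t ^ (2 * (b : ℕ)))) := by
        rw [Finset.sum_comm]
        refine Finset.sum_congr rfl fun i _ => ?_
        rw [Finset.sum_comm]
    _ = _ := by
        refine Finset.sum_congr rfl fun i _ => Finset.sum_congr rfl fun j _ => ?_
        rw [Finset.sum_comm]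
        refine Finset.sum_congr rfl fun a _ => Finset.sum_congr rfl fun b _ => ?_
        rw [mul_div_assoc, div_eq_mul_inv, div_eq_mul_inv, div_eq_mul_inv, mul_inv]
        ring

section

variable {f : ℝ → ℝ} {c : ℕ}

/-- The approximating measure of `tendsto_wronskian_quadratic` is augmented by a mass `r` at the
point `s`. When the Wronskian form vanishes at `u`, letting `r` vary forces the cross term to
vanish. -/
theorem bordered_wronskian_nonneg (hf : AnalyticAt ℝ f 0)
    (hpd : IsPosDefKernel (stationaryKernel f))
    (hodd : ∀ k, 1 ≤ k → k < c → taylorCoeff f (2 * k - 1) = 0)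
    (u : Fin c → ℝ) {s : ℝ} (hs : AnalyticAt ℝ (fun z => f |z - s|) 0) (r : ℝ) :
    0 ≤ r ^ 2 * f 0 + 2 * r * (∑ a, u a * taylorCoeff (fun z => f |z - s|) a) +
      ∑ a, ∑ b, u a * u b * wronskianEntry f a b := by
  set y : Fin c → ℝ := fun j => (j : ℝ) with hydef
  have hy : Function.Injective y := injective_fin_natCast c
  set T := (Matrix.vandermonde y)⁻¹ with hT
  let ω : ℝ → Fin c → ℝ := fun t i => ∑ a, u a * (T a i / t ^ (2 * (a : ℕ)))
  have h1 : Tendsto (fun t : ℝ => ∑ i, ω t i * f |t ^ 2 * y i - s|) (𝓝[>] 0)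
      (𝓝 (∑ a, u a * taylorCoeff (fun z => f |z - s|) a)) := by
    have h : Tendsto (fun t : ℝ => ∑ a, u a * ((∑ i, T a i * f |t ^ 2 * y i - s|) /
        t ^ (2 * (a : ℕ)))) (𝓝[>] 0) (𝓝 (∑ a, u a * taylorCoeff (fun z => f |z - s|) a)) := by
      refine tendsto_finsetSum _ fun a _ => Tendsto.const_mul _ ?_
      have h := tendsto_sum_dilate_div hs y (T a) 2 two_ne_zero a
        (fun j => sum_vandermonde_inv_mul_pow_of_lt hy a (j := j))
      rwa [sum_vandermonde_inv_mul_pow_self hy, mul_one] at h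
    refine h.congr fun t => ?_
    simp only [ω, Finset.sum_mul, Finset.mul_sum, Finset.sum_div]
    rw [Finset.sum_comm]
    refine Finset.sum_congr rfl fun i _ => Finset.sum_congr rfl fun a _ => ?_
    ring
  have h2 := tendsto_wronskian_quadratic hf hodd hy u
  have h3 := ((tendsto_const_nhds (x := r ^ 2 * f 0)).add (h1.const_mul (2 * r))).add h2
  refine ge_of_tendsto' h3 fun t => ?_
  have h4 := hpd.sum_sum_nonneg (ι := Option (Fin c))
    (fun o => o.elim s fun i => t ^ 2 * y i) (fun o => o.elim r (ω t))
  simp only [Fintype.sum_option, Option.elim_none, Option.elim_some, stationaryKernel, sub_self,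
    abs_zero, Finset.sum_add_distrib] at h4
  refine h4.trans_eq ?_
  have h5 : ∀ i j, f |t ^ 2 * y i - t ^ 2 * y j| = f (t ^ 2 * |y i - y j|) := fun i j => by
    rw [← mul_sub, abs_mul, abs_of_nonneg (sq_nonneg t)]
  simp only [h5, abs_sub_comm s, mul_comm _ r, mul_assoc, ← Finset.mul_sum, ω, hT]
  ring

theorem wronskianEntry_symm {a b : ℕ} (h : Odd (a + b) → taylorCoeff f (a + b) = 0) :
    wronskianEntry f a b = wronskianEntry f b a := by
  rcases Nat.even_or_odd (a + b) with he | ho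
  · have hpar : (-1 : ℝ) ^ a = (-1) ^ b := by
      rcases Nat.even_or_odd b with hb | hb
      · rw [hb.neg_one_pow, ((Nat.even_add.1 he).2 hb).neg_one_pow]
      · rw [hb.neg_one_pow,
          (Nat.not_even_iff_odd.1 fun ha => (Nat.not_even_iff_odd.2 hb)
            ((Nat.even_add.1 he).1 ha)).neg_one_pow]
    rw [wronskianEntry, wronskianEntry, hpar, Nat.choose_symm_add, add_comm b a]
  · simp [wronskianEntry, add_comm b a, h ho]

/-- If the Wronskian degenerates, then `f` solves a linear differential equation with constant
coefficients on each side of the origin. -/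
theorem eventually_sum_taylor_eq_zero (hf : AnalyticAt ℝ f 0)
    (hpd : IsPosDefKernel (stationaryKernel f))
    (hodd : ∀ k, 1 ≤ k → k < c → taylorCoeff f (2 * k - 1) = 0) (u : Fin c → ℝ)
    (h0 : ∑ a, ∑ b, u a * u b * wronskianEntry f a b = 0) :
    (∀ᶠ s in 𝓝 0, ∑ a : Fin c, u a / ((a : ℕ)! : ℝ) * iteratedDeriv a f s = 0) ∧
      ∀ᶠ s in 𝓝 0, ∑ a : Fin c, u a / ((a : ℕ)! : ℝ) * (-1) ^ (a : ℕ) * iteratedDeriv a f s = 0 := by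
  have key : ∀ s, AnalyticAt ℝ (fun z => f |z - s|) 0 →
      ∑ a, u a * taylorCoeff (fun z => f |z - s|) a = 0 := fun s hs => by
    refine eq_zero_of_quadratic_nonneg (d := f 0) fun r => ?_
    have := bordered_wronskian_nonneg hf hpd hodd u hs r
    rwa [h0, add_zero] at this
  have han : ∀ a : ℕ, AnalyticAt ℝ (iteratedDeriv a f) 0 := fun a => by
    rw [iteratedDeriv_eq_iterate]; exact hf.iterated_deriv a
  have hev := hf.eventually_analyticAt
  constructor
  -- Positivity yields the equation only for small `s > 0`, where `|z + s|` is smooth in `z` near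
  -- `0`; analyticity extends it to a full neighbourhood.
  · refine (AnalyticAt.frequently_zero_iff_eventually_zero ?_).1
      (Eventually.frequently ?_ |>.filter_mono (nhdsGT_le_nhdsNE (0 : ℝ)))
    · exact Finset.analyticAt_fun_sum _ fun a _ => analyticAt_const.mul (han a)
    · filter_upwards [hev.filter_mono nhdsWithin_le_nhds, self_mem_nhdsWithin] with s hs hs0
      have hs0 : 0 < s := hs0
      have heq : (fun z => f |z - (-s)|) =ᶠ[𝓝 0] fun z => f (z + s) := by
        filter_upwards [lt_mem_nhds (show -s < 0 by linarith)] with z hz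
        rw [abs_of_pos (by linarith), sub_neg_eq_add]
      have ha : AnalyticAt ℝ (fun z => f (z + s)) 0 := by
        refine AnalyticAt.fun_comp (g := f) ?_ (by fun_prop)
        simpa using hs
      have h := key (-s) (ha.congr heq.symm)
      rw [← h]
      refine Finset.sum_congr rfl fun a _ => ?_
      rw [taylorCoeff, heq.iteratedDeriv_eq, iteratedDeriv_comp_add_const]
      simp only [zero_add]; ring
  · refine (AnalyticAt.frequently_zero_iff_eventually_zero ?_).1
      (Eventually.frequently ?_ |>.filter_mono (nhdsGT_le_nhdsNE (0 : ℝ)))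
    · exact Finset.analyticAt_fun_sum _ fun a _ => analyticAt_const.mul (han a)
    · filter_upwards [hev.filter_mono nhdsWithin_le_nhds, self_mem_nhdsWithin] with s hs hs0
      have hs0 : 0 < s := hs0
      have heq : (fun z => f |z - s|) =ᶠ[𝓝 0] fun z => f (s - z) := by
        filter_upwards [gt_mem_nhds hs0] with z hz
        rw [abs_sub_comm, abs_of_pos (by linarith)]
      have ha : AnalyticAt ℝ (fun z => f (s - z)) 0 := by
        refine AnalyticAt.fun_comp (g := f) ?_ (by fun_prop)
        simpa using hs
      have h := key s (ha.congr heq.symm)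
      rw [← h]
      refine Finset.sum_congr rfl fun a _ => ?_
      rw [taylorCoeff, heq.iteratedDeriv_eq, iteratedDeriv_comp_const_sub]
      simp only [sub_zero, smul_eq_mul]; ring

/-- Differentiating a linear differential equation with constant coefficients. -/
theorem eventually_sum_iteratedDeriv_add_eq_zero {w : Fin c → ℝ} {s : ℝ} (hf : AnalyticAt ℝ f s)
    (h : ∀ᶠ z in 𝓝 s, ∑ a : Fin c, w a * iteratedDeriv a f z = 0) (N : ℕ) :
    ∑ a : Fin c, w a * iteratedDeriv (a + N) f s = 0 := by
  have h1 : (fun z => ∑ a : Fin c, w a * iteratedDeriv a f z) =ᶠ[𝓝 s] fun _ => 0 := h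
  have h2 := h1.iteratedDeriv_eq N
  have han : ∀ a : ℕ, AnalyticAt ℝ (iteratedDeriv a f) s := fun a => by
    rw [iteratedDeriv_eq_iterate]; exact hf.iterated_deriv a
  rw [iteratedDeriv_fun_sum (f := fun (a : Fin c) z => w a * iteratedDeriv a f z)
    fun a _ => contDiffAt_const.mul (han a).contDiffAt] at h2
  simp only [iteratedDeriv_const_mul_field, iteratedDeriv_const, ite_self] at h2
  rw [← h2]
  refine Finset.sum_congr rfl fun a _ => ?_
  simp only [iteratedDeriv_eq_iterate, ← Function.iterate_add_apply]
  rw [add_comm]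

end

theorem eventually_eq_zero_of_iteratedDeriv_eq_zero {g : ℝ → ℝ} (hg : AnalyticAt ℝ g 0)
    (h : ∀ k, iteratedDeriv k g 0 = 0) : ∀ᶠ z in 𝓝 0, g z = 0 := by
  refine HasFPowerSeriesAt.eventually_eq_zero (𝕜 := ℝ) ?_
  have h1 := hg.hasFPowerSeriesAt
  have h2 : FormalMultilinearSeries.ofScalars ℝ (fun n => iteratedDeriv n g 0 / (n ! : ℝ)) = 0 := by
    ext n
    simp [FormalMultilinearSeries.ofScalars, h]
  rwa [h2] at h1

theorem iteratedDeriv_eq_zero_of_taylorCoeff {f : ℝ → ℝ} {k : ℕ} (h : taylorCoeff f k = 0) :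
    iteratedDeriv k f 0 = 0 :=
  (div_eq_zero_iff.1 h).resolve_right (by positivity)

theorem eventually_even {f : ℝ → ℝ} (hf : AnalyticAt ℝ f 0)
    (hodd : ∀ k, 1 ≤ k → taylorCoeff f (2 * k - 1) = 0) : ∀ᶠ z in 𝓝 0, f (-z) = f z := by
  have hneg : AnalyticAt ℝ (fun z => f (-z)) 0 :=
    AnalyticAt.fun_comp (g := f) (by simpa using hf) (by fun_prop)
  have h := eventually_eq_zero_of_iteratedDeriv_eq_zero (hneg.sub hf) fun k => by
    rw [iteratedDeriv_sub hneg.contDiffAt hf.contDiffAt, iteratedDeriv_comp_neg, neg_zero]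
    rcases Nat.even_or_odd k with hk | hk
    · simp [hk.neg_one_pow]
    · obtain ⟨q, rfl⟩ := hk
      have h0 : iteratedDeriv (2 * q + 1) f 0 = 0 :=
        iteratedDeriv_eq_zero_of_taylorCoeff (hodd (q + 1) (by omega))
      simp [h0]
  filter_upwards [h] with z hz
  simpa [sub_eq_zero] using hz

/-- A function whose kernel is strictly positive definite and which is even solves no linear
differential equation with constant coefficients. -/
theorem not_isStrictPosDefKernel_of_linear_ode {f : ℝ → ℝ} (hf : AnalyticAt ℝ f 0)
    (hodd : ∀ k, 1 ≤ k → taylorCoeff f (2 * k - 1) = 0) {c : ℕ} {w : Fin c → ℝ} {d : Fin c}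
    (hd : w d ≠ 0) (hdw : ∀ a, d < a → w a = 0)
    (h : ∀ᶠ z in 𝓝 0, ∑ a : Fin c, w a * iteratedDeriv a f z = 0) :
    ¬ IsStrictPosDefKernel (stationaryKernel f) := by
  intro hs
  obtain ⟨ρ, hρ, hball⟩ := Metric.eventually_nhds_iff_ball.1
    (hf.eventually_analyticAt.and ((eventually_even hf hodd).and h.eventually_nhds))
  -- There are `d + 1` points in `[0, ρ / 2)`, one more than the order of the equation. The points
  -- and all their differences stay in the ball where `f` is analytic, even and a solution.
  let y : Fin (d + 1) → ℝ := fun i => ρ / 2 * (i / (d + 1))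
  have hy0 : ∀ i, 0 ≤ y i := fun i => by positivity
  have hyρ : ∀ i, y i < ρ / 2 := fun i => by
    have h1 : ((i : ℕ) : ℝ) < (d : ℕ) + 1 := by exact_mod_cast i.2
    have h2 : ((i : ℕ) : ℝ) / ((d : ℕ) + 1) < 1 := by rw [div_lt_one (by positivity)]; exact h1
    have h3 := mul_lt_mul_of_pos_left h2 (half_pos hρ)
    rwa [mul_one] at h3
  have hyinj : Function.Injective y := fun i j hij => by
    have h1 := mul_left_cancel₀ (half_pos hρ).ne' hij
    rw [div_left_inj' (by positivity)] at h1
    exact Fin.ext (Nat.cast_injective (R := ℝ) h1)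
  have hmem : ∀ i, y i ∈ Metric.ball (0 : ℝ) ρ := fun i => by
    rw [Metric.mem_ball, dist_zero_right, Real.norm_eq_abs, abs_of_nonneg (hy0 i)]
    linarith [hyρ i]
  obtain ⟨v, hv, hv0⟩ : ∃ v : Fin (d + 1) → ℝ,
      (∀ k < (d : ℕ), ∑ i, v i * iteratedDeriv k f (y i) = 0) ∧ v ≠ 0 := by
    let M : Matrix (Fin d) (Fin (d + 1)) ℝ := Matrix.of fun k i => iteratedDeriv k f (y i)
    have hker : M.mulVecLin.ker ≠ ⊥ := LinearMap.ker_ne_bot_of_finrank_lt (by simp)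
    obtain ⟨v, hv, hv0⟩ := (Submodule.ne_bot_iff _).1 hker
    refine ⟨v, fun k hk => ?_, hv0⟩
    have h1 := congrFun (LinearMap.mem_ker.1 hv) ⟨k, hk⟩
    simp only [M, Matrix.mulVecLin_apply, Matrix.mulVec, dotProduct, Matrix.of_apply,
      Pi.zero_apply] at h1
    rw [← h1]
    exact Finset.sum_congr rfl fun i _ => mul_comm _ _
  -- The leading coefficient `w d` being nonzero, the differentiated equation expresses each
  -- derivative of order at least `d` through lower ones.
  have hall : ∀ k, ∑ i, v i * iteratedDeriv k f (y i) = 0 := by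
    intro k
    induction k using Nat.strong_induction_on with
    | _ k ih =>
      rcases lt_or_ge k d with hk | hk
      · exact hv k hk
      · have h1 : ∑ a : Fin c, w a * ∑ i, v i * iteratedDeriv (a + (k - d)) f (y i) = 0 := by
          simp_rw [Finset.mul_sum]
          rw [Finset.sum_comm]
          refine Finset.sum_eq_zero fun i _ => ?_
          have h2 := eventually_sum_iteratedDeriv_add_eq_zero (hball _ (hmem i)).1
            (hball _ (hmem i)).2.2 (k - d)
          rw [← mul_zero (v i), ← h2, Finset.mul_sum]
          exact Finset.sum_congr rfl fun a _ => by ring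
        rw [Finset.sum_eq_single d, Nat.add_sub_cancel' hk] at h1
        · exact (mul_eq_zero.1 h1).resolve_left hd
        · intro a _ had
          rcases lt_or_gt_of_ne had with h3 | h3
          · rw [ih (a + (k - d)) (by have : (a : ℕ) < d := h3; omega), mul_zero]
          · rw [hdw a h3, zero_mul]
        · simp
  -- All derivatives of `F` vanish at `0`, so `F` vanishes up to the points `y j`. By evenness `F (y
  -- j)` is the `j`-th entry of the kernel matrix applied to `v`, which is therefore singular.
  let F : ℝ → ℝ := fun t => ∑ i, v i * f (y i - t)
  have hterm : ∀ i, ∀ t ∈ Metric.ball (0 : ℝ) (ρ / 2), AnalyticAt ℝ (fun t => f (y i - t)) t := by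
    intro i t ht
    refine AnalyticAt.fun_comp (g := f) (hball _ ?_).1 (by fun_prop)
    rw [Metric.mem_ball, dist_zero_right, Real.norm_eq_abs, abs_lt] at ht ⊢
    constructor <;> linarith [hy0 i, hyρ i]
  have hF : AnalyticOnNhd ℝ F (Metric.ball 0 (ρ / 2)) := fun t ht =>
    Finset.analyticAt_fun_sum _ fun i _ => analyticAt_const.mul (hterm i t ht)
  have h0mem : (0 : ℝ) ∈ Metric.ball (0 : ℝ) (ρ / 2) := Metric.mem_ball_self (half_pos hρ)
  have hF0 : ∀ᶠ t in 𝓝 0, F t = 0 := by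
    refine eventually_eq_zero_of_iteratedDeriv_eq_zero (hF 0 h0mem) fun k => ?_
    rw [iteratedDeriv_fun_sum (f := fun i t => v i * f (y i - t))
      fun i _ => contDiffAt_const.mul (hterm i 0 h0mem).contDiffAt]
    simp only [iteratedDeriv_const_mul_field, iteratedDeriv_comp_const_sub, sub_zero, smul_eq_mul]
    rw [← mul_zero ((-1) ^ k), ← hall k, Finset.mul_sum]
    exact Finset.sum_congr rfl fun i _ => by ring
  have hFy : ∀ j, F (y j) = 0 := fun j =>
    hF.eqOn_zero_of_preconnected_of_eventuallyEq_zero (convex_ball _ _).isPreconnected h0mem hF0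
      (by
        rw [Metric.mem_ball, dist_zero_right, Real.norm_eq_abs, abs_of_nonneg (hy0 j)]
        exact hyρ j)
  have hpos := (hs (d + 1) y hyinj).dotProduct_mulVec_pos hv0
  refine hpos.ne' ?_
  simp only [dotProduct, Matrix.mulVec, Matrix.of_apply, star_trivial, stationaryKernel]
  refine Finset.sum_eq_zero fun j _ => ?_
  rw [← mul_zero (v j), ← hFy j]
  congr 1
  refine Finset.sum_congr rfl fun i _ => ?_
  rw [mul_comm, abs_sub_comm]
  congr 1
  rcases abs_choice (y i - y j) with h1 | h1
  · rw [h1]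
  · rw [h1]
    refine (hball _ ?_).2.1
    rw [Metric.mem_ball, dist_zero_right, Real.norm_eq_abs, abs_lt]
    constructor <;> linarith [hy0 i, hyρ i, hy0 j, hyρ j]

theorem eq_zero_of_wronskian_quadratic_eq_zero {f : ℝ → ℝ} (hf : AnalyticAt ℝ f 0)
    (hpd : IsPosDefKernel (stationaryKernel f)) {c : ℕ}
    (hodd : ∀ k, 1 ≤ k → k < c → taylorCoeff f (2 * k - 1) = 0)
    (hdeg : taylorCoeff f (2 * c - 1) ≠ 0 ∨
      ((∀ k, 1 ≤ k → taylorCoeff f (2 * k - 1) = 0) ∧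
        IsStrictPosDefKernel (stationaryKernel f)))
    {u : Fin c → ℝ} (h0 : ∑ a, ∑ b, u a * u b * wronskianEntry f a b = 0) : u = 0 := by
  obtain ⟨hp, hm⟩ := eventually_sum_taylor_eq_zero hf hpd hodd u h0
  by_contra hu
  obtain ⟨a₀, ha₀⟩ := Function.ne_iff.1 hu
  obtain ⟨d, hd, hmax⟩ := Finset.exists_max_image (Finset.univ.filter fun a => u a ≠ 0) id
    ⟨a₀, by simpa using ha₀⟩
  simp only [Finset.mem_filter, Finset.mem_univ, true_and, id] at hd hmax
  have hdu : ∀ a, d < a → u a = 0 := fun a ha => by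
    by_contra h
    exact (hmax a h).not_gt ha
  have hwd : u d / ((d : ℕ)! : ℝ) ≠ 0 := div_ne_zero hd (by positivity)
  rcases hdeg with hfc | ⟨hall, hs⟩
  -- With `d` the top index of `u`, differentiate both equations `2 * c - 1 - d` times at `0` and
  -- add them with sign `(-1) ^ d`. Only indices of the parity of `d` survive. Those below `d` carry
  -- odd Taylor coefficients of order below `2 * c - 1`, which vanish, so only `f_{2c-1}` remains.
  · have h1 := eventually_sum_iteratedDeriv_add_eq_zero hf hp (2 * c - 1 - d)
    have h2 := eventually_sum_iteratedDeriv_add_eq_zero hf hm (2 * c - 1 - d)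
    have h3 : ∑ a : Fin c, u a / ((a : ℕ)! : ℝ) * (1 + (-1) ^ (a + d : ℕ)) *
        iteratedDeriv (a + (2 * c - 1 - d)) f 0 = 0 := by
      have h4 := congrArg₂ (fun r s : ℝ => r + (-1) ^ (d : ℕ) * s) h1 h2
      simp only [mul_zero, add_zero, Finset.mul_sum, ← Finset.sum_add_distrib] at h4
      refine Eq.trans ?_ h4
      exact Finset.sum_congr rfl fun a _ => by rw [pow_add]; ring
    have hdc := d.2
    rw [Finset.sum_eq_single d] at h3
    · rw [show (d : ℕ) + (2 * c - 1 - d) = 2 * c - 1 by omega,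
        (Even.add_self (d : ℕ)).neg_one_pow] at h3
      have h4 : iteratedDeriv (2 * c - 1) f 0 ≠ 0 := fun h => hfc (by rw [taylorCoeff, h, zero_div])
      exact h4 ((mul_eq_zero.1 h3).resolve_left (mul_ne_zero hwd (by norm_num)))
    · intro a _ had
      rcases lt_or_gt_of_ne had with h | h
      · have h' : (a : ℕ) < d := h
        rcases Nat.even_or_odd (a + d : ℕ) with he | ho
        · obtain ⟨q, hq⟩ := he
          have h5 := hodd (c - (d - q)) (by omega) (by omega)
          rw [show 2 * (c - (d - q)) - 1 = (a : ℕ) + (2 * c - 1 - d) by omega] at h5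
          rw [iteratedDeriv_eq_zero_of_taylorCoeff h5, mul_zero]
        · rw [ho.neg_one_pow]; ring
      · rw [hdu a h]; ring
    · simp
  · exact not_isStrictPosDefKernel_of_linear_ode hf hall (w := fun a => u a / ((a : ℕ)! : ℝ)) hwd
      (fun a ha => by rw [hdu a ha, zero_div]) hp hs

/-- The Wronskian of a stationary kernel, in terms of the Taylor coefficients of `f`. -/
noncomputable def wronskianMatrix (f : ℝ → ℝ) (c : ℕ) : Matrix (Fin c) (Fin c) ℝ :=
  Matrix.of fun a b => wronskianEntry f a b

theorem posDef_wronskianMatrix {f : ℝ → ℝ} (hf : AnalyticAt ℝ f 0)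
    (hpd : IsPosDefKernel (stationaryKernel f)) {c : ℕ}
    (hodd : ∀ k, 1 ≤ k → k < c → taylorCoeff f (2 * k - 1) = 0)
    (hdeg : taylorCoeff f (2 * c - 1) ≠ 0 ∨
      ((∀ k, 1 ≤ k → taylorCoeff f (2 * k - 1) = 0) ∧
        IsStrictPosDefKernel (stationaryKernel f))) :
    (wronskianMatrix f c).PosDef := by
  have hquad : ∀ u : Fin c → ℝ, star u ⬝ᵥ wronskianMatrix f c *ᵥ u =
      ∑ a, ∑ b, u a * u b * wronskianEntry f a b := fun u => by
    simp only [dotProduct, Matrix.mulVec, wronskianMatrix, Matrix.of_apply, star_trivial,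
      Finset.mul_sum]
    exact Finset.sum_congr rfl fun a _ => Finset.sum_congr rfl fun b _ => by ring
  refine Matrix.PosDef.of_dotProduct_mulVec_pos ?_ fun u hu => ?_
  · ext a b
    simp only [Matrix.conjTranspose_apply, wronskianMatrix, Matrix.of_apply, star_trivial]
    refine wronskianEntry_symm fun h => ?_
    obtain ⟨q, hq⟩ := h
    have ha := a.2
    have hb := b.2
    rw [hq]
    exact hodd (q + 1) (by omega) (by omega)
  · rw [hquad]
    refine lt_of_le_of_ne ?_ fun h => hu (eq_zero_of_wronskian_quadratic_eq_zero hf hpd hodd hdeg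
      h.symm)
    refine ge_of_tendsto' (tendsto_wronskian_quadratic hf hodd (injective_fin_natCast c) u)
      fun t => kernel_dilate_nonneg hpd _ _ t

theorem posDef_wronskianMatrix_of_le {f : ℝ → ℝ} {c k : ℕ} (h : (wronskianMatrix f c).PosDef)
    (hk : k ≤ c) : (wronskianMatrix f k).PosDef :=
  h.submatrix (Fin.castLE_injective hk)

/-! ### Determinants of kernel matrices in the flat limit -/

section Det

variable {m : ℕ}

/-- The matrix of a bilinear form on the points `y` in the functionals dual to the monomials. -/
noncomputable def dualMatrix (y : Fin m → ℝ) (A : Matrix (Fin m) (Fin m) ℝ) :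
    Matrix (Fin m) (Fin m) ℝ :=
  (Matrix.vandermonde y)⁻¹ * A * (Matrix.vandermonde y)⁻¹ᵀ

theorem dualMatrix_apply (y : Fin m → ℝ) (A : Matrix (Fin m) (Fin m) ℝ) (a b : Fin m) :
    dualMatrix y A a b =
      ∑ i, ∑ j, (Matrix.vandermonde y)⁻¹ a i * (Matrix.vandermonde y)⁻¹ b j * A i j := by
  simp only [dualMatrix, Matrix.mul_apply, Matrix.transpose_apply, Finset.sum_mul]
  rw [Finset.sum_comm]
  exact Finset.sum_congr rfl fun i _ => Finset.sum_congr rfl fun j _ => by ring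

theorem det_eq_det_dualMatrix {y : Fin m → ℝ} (hy : Function.Injective y)
    (A : Matrix (Fin m) (Fin m) ℝ) :
    A.det = (Matrix.vandermonde y).det ^ 2 * (dualMatrix y A).det := by
  have h := congrArg Matrix.det (vandermonde_inv_mul hy)
  rw [Matrix.det_mul, Matrix.det_one] at h
  rw [dualMatrix, Matrix.det_mul, Matrix.det_mul, Matrix.det_transpose]
  linear_combination (-A.det * ((Matrix.vandermonde y)⁻¹.det * (Matrix.vandermonde y).det + 1)) * h

/-- The limit of the kernel matrix in the functionals dual to the monomials, rescaled. -/
noncomputable def limitMatrix (f : ℝ → ℝ) (c : ℕ) (y : Fin m → ℝ) : Matrix (Fin m) (Fin m) ℝ :=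
  Matrix.of fun a b =>
    (if (a : ℕ) < c ∧ (b : ℕ) < c then wronskianEntry f a b else 0) +
      if c ≤ (a : ℕ) ∧ c ≤ (b : ℕ) then
        dualMatrix y (taylorCoeff f (2 * c - 1) • distMatrix y (2 * c - 1)) a b else 0

variable {f : ℝ → ℝ} {c : ℕ}

/-- In the dual basis, dividing row `a` and column `a` by `t ^ growthExp c a` makes every entry
converge; each scaling occurs twice, whence the factor `2` in the exponent. -/
theorem tendsto_det_kernelMatrix (hf : AnalyticAt ℝ f 0) (hc : 1 ≤ c)
    (hodd : ∀ k, 1 ≤ k → k < c → taylorCoeff f (2 * k - 1) = 0)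
    {y : Fin m → ℝ} (hy : Function.Injective y) :
    Tendsto (fun t : ℝ => (kernelMatrix f y (t ^ 2)).det /
        t ^ (2 * ∑ a ∈ Finset.range m, growthExp c a)) (𝓝[>] 0)
      (𝓝 ((Matrix.vandermonde y).det ^ 2 * (limitMatrix f c y).det)) := by
  have h1 : Tendsto (fun t : ℝ => (Matrix.of fun a b : Fin m =>
      dualMatrix y (kernelMatrix f y (t ^ 2)) a b / t ^ (growthExp c a + growthExp c b)).det)
      (𝓝[>] 0) (𝓝 (limitMatrix f c y).det) := by
    refine ((continuous_id.matrix_det).tendsto _).comp ?_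
    refine tendsto_pi_nhds.2 fun a => tendsto_pi_nhds.2 fun b => ?_
    have h := tendsto_bilin hf hc hodd
      (fun j => sum_vandermonde_inv_mul_pow_of_lt hy a (j := j))
      (fun j => sum_vandermonde_inv_mul_pow_of_lt hy b (j := j))
    simp only [sum_vandermonde_inv_mul_pow_self hy, mul_one] at h
    simp only [Matrix.of_apply, dualMatrix_apply, kernelMatrix, distMatrix,
      Matrix.smul_apply, smul_eq_mul, mul_left_comm _ (taylorCoeff f (2 * c - 1)),
      ← Finset.mul_sum]
    exact h
  refine (h1.const_mul ((Matrix.vandermonde y).det ^ 2)).congr' ?_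
  filter_upwards [self_mem_nhdsWithin] with t ht
  have h2 : (Matrix.of fun a b : Fin m =>
      dualMatrix y (kernelMatrix f y (t ^ 2)) a b / t ^ (growthExp c a + growthExp c b)) =
      Matrix.of fun a b : Fin m => (t ^ growthExp c a)⁻¹ * Matrix.of (fun a b : Fin m =>
        (t ^ growthExp c b)⁻¹ * dualMatrix y (kernelMatrix f y (t ^ 2)) a b) a b := by
    ext a b
    simp only [Matrix.of_apply, pow_add, div_eq_mul_inv, mul_inv]
    ring
  have h3 : ∏ a : Fin m, (t ^ growthExp c a)⁻¹ =
      (t ^ (∑ a ∈ Finset.range m, growthExp c a))⁻¹ := by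
    rw [Finset.prod_inv_distrib, Finset.prod_pow_eq_pow_sum,
      Fin.sum_univ_eq_sum_range (growthExp c) m]
  rw [h2, Matrix.det_mul_column, Matrix.det_mul_row, h3,
    det_eq_det_dualMatrix hy (kernelMatrix f y (t ^ 2)), mul_comm 2, pow_mul]
  ring

/-- The part of the dual matrix on the functionals that annihilate the degrees less than `q`. -/
noncomputable def dualBlock (q k : ℕ) (y : Fin (q + k) → ℝ)
    (A : Matrix (Fin (q + k)) (Fin (q + k)) ℝ) : Matrix (Fin k) (Fin k) ℝ :=
  (dualMatrix y A).submatrix (Fin.natAdd q) (Fin.natAdd q)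

theorem det_limitMatrix_of_le (hmc : m ≤ c) (y : Fin m → ℝ) :
    (limitMatrix f c y).det = (wronskianMatrix f m).det := by
  congr 1
  ext a b
  have ha := a.2
  have hb := b.2
  simp only [limitMatrix, wronskianMatrix, Matrix.of_apply]
  rw [if_pos (by omega), if_neg (by omega), add_zero]

theorem det_limitMatrix_add (q : ℕ) (y : Fin (c + q) → ℝ) :
    (limitMatrix f c y).det = (wronskianMatrix f c).det *
      (dualBlock c q y (taylorCoeff f (2 * c - 1) • distMatrix y (2 * c - 1))).det := by
  rw [← Matrix.det_submatrix_equiv_self finSumFinEquiv, ← Matrix.det_fromBlocks_zero₂₁ _ 0]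
  congr 1
  ext a b
  rcases a with a | a <;> rcases b with b | b <;>
    simp [limitMatrix, wronskianMatrix, dualBlock]

theorem dualBlock_quadratic (q k : ℕ) (y : Fin (q + k) → ℝ)
    (A : Matrix (Fin (q + k)) (Fin (q + k)) ℝ) (z : Fin k → ℝ) :
    z ⬝ᵥ dualBlock q k y A *ᵥ z = ∑ i, ∑ j,
      (∑ a, z a * (Matrix.vandermonde y)⁻¹ (Fin.natAdd q a) i) *
      (∑ a, z a * (Matrix.vandermonde y)⁻¹ (Fin.natAdd q a) j) * A i j := by
  simp only [dotProduct, Matrix.mulVec, dualBlock, Matrix.submatrix_apply, dualMatrix_apply,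
    Finset.sum_mul, Finset.mul_sum]
  calc _ = ∑ a, ∑ i, ∑ j, ∑ b, z a * ((Matrix.vandermonde y)⁻¹ (Fin.natAdd q a) i *
        (Matrix.vandermonde y)⁻¹ (Fin.natAdd q b) j * A i j * z b) := by
        refine Finset.sum_congr rfl fun a _ => ?_
        rw [Finset.sum_comm]
        refine Finset.sum_congr rfl fun i _ => ?_
        rw [Finset.sum_comm]
    _ = ∑ i, ∑ j, ∑ a, ∑ b, z a * ((Matrix.vandermonde y)⁻¹ (Fin.natAdd q a) i *
        (Matrix.vandermonde y)⁻¹ (Fin.natAdd q b) j * A i j * z b) := by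
        rw [Finset.sum_comm]
        refine Finset.sum_congr rfl fun i _ => ?_
        rw [Finset.sum_comm]
    _ = _ := by
        refine Finset.sum_congr rfl fun i _ => Finset.sum_congr rfl fun j _ => ?_
        rw [Finset.sum_comm]
        exact Finset.sum_congr rfl fun a _ => Finset.sum_congr rfl fun b _ => by ring

theorem sum_dual_mul_pow {q k : ℕ} {y : Fin (q + k) → ℝ} (hy : Function.Injective y)
    (z : Fin k → ℝ) (b : Fin (q + k)) :
    ∑ i, (∑ a, z a * (Matrix.vandermonde y)⁻¹ (Fin.natAdd q a) i) * y i ^ (b : ℕ) =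
      ∑ a, z a * if Fin.natAdd q a = b then 1 else 0 := by
  simp only [← sum_vandermonde_inv_mul_pow hy, Finset.sum_mul, Finset.mul_sum, mul_assoc]
  rw [Finset.sum_comm]

theorem sum_dual_mul_pow_of_lt {q k : ℕ} {y : Fin (q + k) → ℝ} (hy : Function.Injective y)
    (z : Fin k → ℝ) (j : ℕ) (hj : j < q) :
    ∑ i, (∑ a, z a * (Matrix.vandermonde y)⁻¹ (Fin.natAdd q a) i) * y i ^ j = 0 := by
  refine (sum_dual_mul_pow hy z ⟨j, by omega⟩).trans (Finset.sum_eq_zero fun a _ => ?_)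
  rw [if_neg (by rw [Fin.ext_iff, Fin.val_natAdd]; simp only; omega), mul_zero]

theorem isSymm_distMatrix (y : Fin m → ℝ) (q : ℕ) : (distMatrix y q).IsSymm := by
  ext i j
  simp [distMatrix, abs_sub_comm]

theorem isHermitian_dualBlock (q k : ℕ) (y : Fin (q + k) → ℝ)
    {A : Matrix (Fin (q + k)) (Fin (q + k)) ℝ} (hA : A.IsSymm) :
    (dualBlock q k y A).IsHermitian := by
  refine Matrix.IsHermitian.submatrix ?_ _
  rw [Matrix.IsHermitian, Matrix.conjTranspose_eq_transpose_of_trivial, dualMatrix,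
    Matrix.transpose_mul, Matrix.transpose_mul, Matrix.transpose_transpose, hA.eq, Matrix.mul_assoc]

theorem dualBlock_dist_quadratic (r : ℝ) (q k e : ℕ) (y : Fin (q + k) → ℝ) (z : Fin k → ℝ) :
    z ⬝ᵥ dualBlock q k y (r • distMatrix y e) *ᵥ z = r * ∑ i, ∑ j,
      (∑ a, z a * (Matrix.vandermonde y)⁻¹ (Fin.natAdd q a) i) *
      (∑ a, z a * (Matrix.vandermonde y)⁻¹ (Fin.natAdd q a) j) * |y i - y j| ^ e := by
  rw [dualBlock_quadratic, Finset.mul_sum]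
  refine Finset.sum_congr rfl fun i _ => ?_
  rw [Finset.mul_sum]
  refine Finset.sum_congr rfl fun j _ => ?_
  rw [Matrix.smul_apply, distMatrix, Matrix.of_apply, smul_eq_mul]
  ring

section Positivity

variable (hf : AnalyticAt ℝ f 0) (hpd : IsPosDefKernel (stationaryKernel f)) (hc : 1 ≤ c)
  (hodd : ∀ k, 1 ≤ k → k < c → taylorCoeff f (2 * k - 1) = 0)

include hf hpd hc hodd

theorem posSemidef_dualBlock_dist (q : ℕ) {y : Fin (c + q) → ℝ} (hy : Function.Injective y) :
    (dualBlock c q y (taylorCoeff f (2 * c - 1) • distMatrix y (2 * c - 1))).PosSemidef := by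
  refine Matrix.posSemidef_iff_dotProduct_mulVec.2
    ⟨isHermitian_dualBlock _ _ _ ((isSymm_distMatrix _ _).smul _), fun z => ?_⟩
  rw [star_trivial, dualBlock_dist_quadratic]
  exact taylorCoeff_mul_sum_sum_dist_nonneg hf hpd hc hodd (sum_dual_mul_pow_of_lt hy z)

theorem posDef_dualBlock_dist (hfc : taylorCoeff f (2 * c - 1) ≠ 0) (q : ℕ)
    {y : Fin (c + q) → ℝ} (hy : Function.Injective y) :
    (dualBlock c q y (taylorCoeff f (2 * c - 1) • distMatrix y (2 * c - 1))).PosDef := by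
  refine Matrix.PosDef.of_dotProduct_mulVec_pos
    (isHermitian_dualBlock _ _ _ ((isSymm_distMatrix _ _).smul _)) fun z hz => ?_
  rw [star_trivial, dualBlock_dist_quadratic]
  refine lt_of_le_of_ne (taylorCoeff_mul_sum_sum_dist_nonneg hf hpd hc hodd
    (sum_dual_mul_pow_of_lt hy z)) fun h => hz ?_
  have h1 := eq_zero_of_sum_sum_dist_eq_zero hf hpd hc hodd hfc hy (sum_dual_mul_pow_of_lt hy z)
    ((mul_eq_zero.1 h.symm).resolve_left hfc)
  funext a
  -- The moment of order `c + a` of the functional with coordinates `z` recovers `z a`.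
  have h2 := sum_dual_mul_pow hy z (Fin.natAdd c a)
  simp only [fun i => congrFun h1 i, Pi.zero_apply, zero_mul, Finset.sum_const_zero] at h2
  simpa using h2.symm

variable (hW : (wronskianMatrix f c).PosDef)

include hW

theorem det_limitMatrix_nonneg {y : Fin m → ℝ} (hy : Function.Injective y) :
    0 ≤ (limitMatrix f c y).det := by
  rcases le_total m c with h | h
  · rw [det_limitMatrix_of_le h]
    exact (posDef_wronskianMatrix_of_le hW h).det_pos.le
  · obtain ⟨q, rfl⟩ := Nat.exists_eq_add_of_le h
    rw [det_limitMatrix_add]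
    exact mul_nonneg hW.det_pos.le (posSemidef_dualBlock_dist hf hpd hc hodd q hy).det_nonneg

theorem det_limitMatrix_pos (hm : m ≤ c ∨ taylorCoeff f (2 * c - 1) ≠ 0) {y : Fin m → ℝ}
    (hy : Function.Injective y) : 0 < (limitMatrix f c y).det := by
  rcases le_or_gt m c with h | h
  · rw [det_limitMatrix_of_le h]
    exact (posDef_wronskianMatrix_of_le hW h).det_pos
  · obtain ⟨q, rfl⟩ := Nat.exists_eq_add_of_le h.le
    rw [det_limitMatrix_add]
    exact mul_pos hW.det_pos
      (posDef_dualBlock_dist hf hpd hc hodd (hm.resolve_left h.not_ge) q hy).det_pos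

end Positivity

end Det

/-! ### Bordered determinants -/

theorem det_fromBlocks_one_one_zero {q : ℕ} (B : Matrix (Fin q) (Fin q) ℝ) :
    (Matrix.fromBlocks B 1 1 (0 : Matrix (Fin q) (Fin q) ℝ)).det = (-1) ^ q := by
  have h : Matrix.fromBlocks B 1 1 (0 : Matrix (Fin q) (Fin q) ℝ) * Matrix.fromBlocks 1 0 (1 - B) 1 =
      (Matrix.fromBlocks 1 1 1 0 : Matrix (Fin q ⊕ Fin q) (Fin q ⊕ Fin q) ℝ) := by
    simp [Matrix.fromBlocks_multiply]
  have h2 := congrArg Matrix.det h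
  rw [Matrix.det_mul, Matrix.det_fromBlocks_one₁₁, Matrix.det_fromBlocks_one₁₁] at h2
  simpa [Matrix.det_neg] using h2

/-- The saddle block is invertible and its inverse has zero upper left corner. The couplings meet
only that corner, so the Schur complement is `B₂₂` itself. -/
theorem det_fromBlocks_saddle {q k : ℕ} (B₁₁ : Matrix (Fin q) (Fin q) ℝ)
    (B₁₂ : Matrix (Fin q) (Fin k) ℝ) (B₂₁ : Matrix (Fin k) (Fin q) ℝ)
    (B₂₂ : Matrix (Fin k) (Fin k) ℝ) :
    (Matrix.fromBlocks B₂₂ (Matrix.fromCols B₂₁ 0) (Matrix.fromRows B₁₂ 0)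
      (Matrix.fromBlocks B₁₁ 1 1 (0 : Matrix (Fin q) (Fin q) ℝ))).det = (-1) ^ q * B₂₂.det := by
  let _ : Invertible (Matrix.fromBlocks B₁₁ 1 1 (0 : Matrix (Fin q) (Fin q) ℝ)) :=
    ⟨Matrix.fromBlocks 0 1 1 (-B₁₁), by simp [Matrix.fromBlocks_multiply],
      by simp [Matrix.fromBlocks_multiply]⟩
  have hinv : ⅟(Matrix.fromBlocks B₁₁ 1 1 (0 : Matrix (Fin q) (Fin q) ℝ)) =
    Matrix.fromBlocks 0 1 1 (-B₁₁) := rfl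
  rw [Matrix.det_fromBlocks₂₂, det_fromBlocks_one_one_zero, hinv, Matrix.fromCols_mul_fromBlocks,
    Matrix.fromCols_mul_fromRows]
  simp

/-- Passing to the dual basis turns the Vandermonde border into the first `q` coordinate vectors;
eliminating these directions leaves `dualBlock`. -/
theorem det_fromBlocks_vanderLT {q k : ℕ} {y : Fin (q + k) → ℝ} (hy : Function.Injective y)
    (A : Matrix (Fin (q + k)) (Fin (q + k)) ℝ) :
    (Matrix.fromBlocks A (vanderLT y q) (vanderLT y q)ᵀ 0).det =
      (-1) ^ q * ((Matrix.vandermonde y).det ^ 2 * (dualBlock q k y A).det) := by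
  set T := (Matrix.vandermonde y)⁻¹ with hT
  set E : Matrix (Fin (q + k)) (Fin q) ℝ := T * vanderLT y q with hE
  have hEapp : ∀ a b, E a b = if a = Fin.castAdd k b then 1 else 0 := fun a b => by
    rw [← sum_vandermonde_inv_mul_pow hy, hE, Matrix.mul_apply]
    rfl
  have h1 : Matrix.fromBlocks T 0 0 1 * Matrix.fromBlocks A (vanderLT y q) (vanderLT y q)ᵀ 0 *
      Matrix.fromBlocks Tᵀ 0 0 (1 : Matrix (Fin q) (Fin q) ℝ) =
      Matrix.fromBlocks (dualMatrix y A) E Eᵀ 0 := by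
    simp [Matrix.fromBlocks_multiply, dualMatrix, hE, hT]
  -- The reordering lists the indices from `q` on first, then those below `q`, then the border,
  -- which is the shape of `det_fromBlocks_saddle`.
  let e : Fin k ⊕ (Fin q ⊕ Fin q) ≃ Fin (q + k) ⊕ Fin q :=
    (Equiv.sumAssoc (Fin k) (Fin q) (Fin q)).symm.trans
      (((Equiv.sumComm (Fin k) (Fin q)).trans finSumFinEquiv).sumCongr (Equiv.refl _))
  have h2 : (Matrix.fromBlocks (dualMatrix y A) E Eᵀ 0).det =
      (-1) ^ q * (dualBlock q k y A).det := by
    rw [← Matrix.det_submatrix_equiv_self e, ← det_fromBlocks_saddle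
      ((dualMatrix y A).submatrix (Fin.castAdd k) (Fin.castAdd k))
      ((dualMatrix y A).submatrix (Fin.castAdd k) (Fin.natAdd q))
      ((dualMatrix y A).submatrix (Fin.natAdd q) (Fin.castAdd k))]
    congr 1
    ext a b
    rcases a with a | a | a <;> rcases b with b | b | b <;>
      simp [e, hEapp, dualBlock, Matrix.one_apply, Fin.ext_iff, eq_comm] <;> omega
  have h3 := congrArg Matrix.det (vandermonde_inv_mul hy)
  rw [Matrix.det_mul, Matrix.det_one] at h3
  have h4 := congrArg Matrix.det h1
  rw [Matrix.det_mul, Matrix.det_mul, Matrix.det_fromBlocks_zero₂₁, Matrix.det_fromBlocks_zero₂₁,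
    Matrix.det_transpose, Matrix.det_one, mul_one, h2] at h4
  set d := (Matrix.fromBlocks A (vanderLT y q) (vanderLT y q)ᵀ 0).det
  linear_combination (Matrix.vandermonde y).det ^ 2 * h4 -
    d * (T.det * (Matrix.vandermonde y).det + 1) * h3

/-- A border wider than the number of points has a kernel vector; hence sets with fewer than `q`
points have weight zero. -/
theorem det_fromBlocks_eq_zero_of_lt {m q : ℕ} (h : m < q) (A : Matrix (Fin m) (Fin m) ℝ)
    (B : Matrix (Fin m) (Fin q) ℝ) : (Matrix.fromBlocks A B Bᵀ 0).det = 0 := by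
  have hker : B.mulVecLin.ker ≠ ⊥ := LinearMap.ker_ne_bot_of_finrank_lt (by simpa using h)
  obtain ⟨v, hv, hv0⟩ := (Submodule.ne_bot_iff _).1 hker
  have hv' : B *ᵥ v = 0 := LinearMap.mem_ker.1 hv
  refine Matrix.exists_mulVec_eq_zero_iff.1 ⟨Sum.elim 0 v, fun h0 => hv0 ?_, ?_⟩
  · funext i
    exact congrFun h0 (Sum.inr i)
  · rw [Matrix.fromBlocks_mulVec]
    funext i
    rcases i with i | i <;> simp [hv']

/-! ### Restriction to a subset of the points -/

section Restrict

variable {n : ℕ} (x : Fin n → ℝ) {m : ℕ} (X : Finset (Fin n)) (h : X.card = m)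

/-- The points of index in `X`, in increasing order of the indices. -/
def points : Fin m → ℝ := x ∘ X.orderEmbOfFin h

variable {x} in
theorem points_injective (hx : Function.Injective x) : Function.Injective (points x X h) :=
  hx.comp (X.orderEmbOfFin h).injective

theorem det_restrict (L : Matrix (Fin n) (Fin n) ℝ) :
    (restrict L X).det = (L.submatrix (X.orderEmbOfFin h) (X.orderEmbOfFin h)).det := by
  rw [← Matrix.det_submatrix_equiv_self (X.orderIsoOfFin h).toEquiv]
  rfl

theorem extendedWeight_eq {q : ℕ} (L : Matrix (Fin n) (Fin n) ℝ) (V : Matrix (Fin n) (Fin q) ℝ) :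
    extendedWeight L V X = (-1) ^ q *
      (Matrix.fromBlocks (L.submatrix (X.orderEmbOfFin h) (X.orderEmbOfFin h))
        (V.submatrix (X.orderEmbOfFin h) id) (V.submatrix (X.orderEmbOfFin h) id)ᵀ 0).det := by
  rw [extendedWeight, ← Matrix.det_submatrix_equiv_self
    ((X.orderIsoOfFin h).toEquiv.sumCongr (Equiv.refl (Fin q)))]
  congr 2
  ext a b
  rcases a with a | a <;> rcases b with b | b <;> rfl

theorem extendedWeight_vanderLT_of_lt {q : ℕ} (hX : X.card < q) (L : Matrix (Fin n) (Fin n) ℝ) :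
    extendedWeight L (vanderLT x q) X = 0 := by
  rw [extendedWeight_eq X rfl, det_fromBlocks_eq_zero_of_lt hX, mul_zero]

variable {x X} in
theorem extendedWeight_vanderLT_add (hx : Function.Injective x) {q k : ℕ} (hX : X.card = q + k)
    (L : Matrix (Fin n) (Fin n) ℝ) :
    extendedWeight L (vanderLT x q) X = (Matrix.vandermonde (points x X hX)).det ^ 2 *
      (dualBlock q k (points x X hX)
        (L.submatrix (X.orderEmbOfFin hX) (X.orderEmbOfFin hX))).det := by
  rw [extendedWeight_eq X hX]
  have h1 := det_fromBlocks_vanderLT (points_injective X hX hx)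
    (L.submatrix (X.orderEmbOfFin hX) (X.orderEmbOfFin hX))
  have h2 : (vanderLT x q).submatrix (X.orderEmbOfFin hX) id = vanderLT (points x X hX) q := rfl
  rw [h2, h1, ← mul_assoc, ← mul_pow]
  norm_num

end Restrict

/-! ### The Wronskian -/

section Wronskian

variable {f : ℝ → ℝ} {l : ℕ}

/-- The two branches glue at `0` because odd derivatives of `f` of order below `2 * l` vanish there.
Away from `0` the rules used for `deriv` need no differentiability, so the formula is global
although `f` is analytic only near `0`. -/
theorem iteratedDeriv_comp_abs (hf : AnalyticAt ℝ f 0)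
    (hodd : ∀ k, 1 ≤ k → k < l + 1 → taylorCoeff f (2 * k - 1) = 0) {j : ℕ} (hj : j ≤ 2 * l) :
    iteratedDeriv j (fun t => f |t|) = fun t =>
      if 0 ≤ t then iteratedDeriv j f t else (-1) ^ j * iteratedDeriv j f (-t) := by
  induction j with
  | zero =>
    funext t
    split_ifs with h
    · simp [abs_of_nonneg h]
    · simp [abs_of_neg (not_le.1 h)]
  | succ j ih =>
    have hvan : ∀ i ≤ 2 * l, (-1) ^ i * iteratedDeriv i f 0 = iteratedDeriv i f 0 := by
      intro i hi
      rcases Nat.even_or_odd i with he | ⟨q, rfl⟩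
      · rw [he.neg_one_pow, one_mul]
      · have := iteratedDeriv_eq_zero_of_taylorCoeff (hodd (q + 1) (by omega) (by omega))
        rw [show 2 * (q + 1) - 1 = 2 * q + 1 by omega] at this
        rw [this, mul_zero]
    rw [iteratedDeriv_succ, ih (by omega)]
    funext t
    rcases lt_trichotomy t 0 with ht | rfl | ht
    · rw [if_neg (not_le.2 ht)]
      have : (fun t => if 0 ≤ t then iteratedDeriv j f t else (-1) ^ j * iteratedDeriv j f (-t))
          =ᶠ[𝓝 t] fun t => (-1) ^ j * iteratedDeriv j f (-t) := by
        filter_upwards [gt_mem_nhds ht] with z hz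
        rw [if_neg (not_le.2 hz)]
      rw [this.deriv_eq, deriv_const_mul_field, deriv_comp_neg, ← iteratedDeriv_succ, pow_succ]
      ring
    · rw [if_pos le_rfl]
      have hd : HasDerivAt (iteratedDeriv j f) (iteratedDeriv (j + 1) f 0) 0 := by
        rw [iteratedDeriv_succ]
        refine DifferentiableAt.hasDerivAt (AnalyticAt.differentiableAt ?_)
        rw [iteratedDeriv_eq_iterate]
        exact hf.iterated_deriv j
      have hr : HasDerivWithinAt (fun t => if 0 ≤ t then iteratedDeriv j f t else
          (-1) ^ j * iteratedDeriv j f (-t)) (iteratedDeriv (j + 1) f 0) (Set.Ici 0) 0 :=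
        hd.hasDerivWithinAt.congr (fun z hz => if_pos hz) (if_pos le_rfl)
      have hd' : HasDerivAt (fun t => (-1) ^ j * iteratedDeriv j f (-t))
          (iteratedDeriv (j + 1) f 0) 0 := by
        rw [← hvan (j + 1) hj]
        have h0 : HasDerivAt (iteratedDeriv j f) (iteratedDeriv (j + 1) f 0) (-0) := by
          rwa [neg_zero]
        refine ((h0.comp (0 : ℝ) (hasDerivAt_neg (0 : ℝ))).const_mul ((-1 : ℝ) ^ j)).congr_deriv ?_
        rw [pow_succ]; ring
      have hl : HasDerivWithinAt (fun t => if 0 ≤ t then iteratedDeriv j f t else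
          (-1) ^ j * iteratedDeriv j f (-t)) (iteratedDeriv (j + 1) f 0) (Set.Iic 0) 0 := by
        refine hd'.hasDerivWithinAt.congr (fun z hz => ?_) ?_
        · rcases (show z ≤ 0 from hz).lt_or_eq with h | rfl
          · rw [if_neg (not_le.2 h)]
          · rw [if_pos le_rfl, neg_zero, hvan j (by omega)]
        · rw [if_pos le_rfl, neg_zero, hvan j (by omega)]
      have h := hl.union hr
      rw [Set.Iic_union_Ici, hasDerivWithinAt_univ] at h
      exact h.deriv
    · rw [if_pos ht.le]
      have : (fun t => if 0 ≤ t then iteratedDeriv j f t else (-1) ^ j * iteratedDeriv j f (-t))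
          =ᶠ[𝓝 t] iteratedDeriv j f := by
        filter_upwards [lt_mem_nhds ht] with z hz
        rw [if_pos hz.le]
      rw [this.deriv_eq, ← iteratedDeriv_succ]

theorem wronskian_eq (hf : AnalyticAt ℝ f 0)
    (hodd : ∀ k, 1 ≤ k → k < l + 1 → taylorCoeff f (2 * k - 1) = 0) :
    wronskian (stationaryKernel f) l = wronskianMatrix f (l + 1) := by
  ext i j
  have hi := i.2
  have hj := j.2
  simp only [wronskian, wronskianMatrix, Matrix.of_apply, stationaryKernel]
  have h1 : (fun s => iteratedDeriv (j : ℕ) (fun t => f |s - t|) 0) =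
      fun s => (-1) ^ (j : ℕ) * iteratedDeriv j (fun t => f |t|) s := by
    funext s
    rw [iteratedDeriv_comp_const_sub (j : ℕ) (fun t => f |t|) s]
    simp
  have h2 : iteratedDeriv (i : ℕ) (iteratedDeriv (j : ℕ) fun t => f |t|) =
      iteratedDeriv (i + j : ℕ) fun t => f |t| := by
    simp only [iteratedDeriv_eq_iterate, ← Function.iterate_add_apply]
  rw [h1, iteratedDeriv_const_mul_field, h2, iteratedDeriv_comp_abs hf hodd (by omega)]
  simp only [le_refl, if_true]
  rw [wronskianEntry, taylorCoeff, ← Nat.add_choose_mul_factorial_mul_factorial,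
    ← Nat.choose_symm_add]
  push_cast
  have h3 : (((i : ℕ) + (j : ℕ)).choose i : ℝ) ≠ 0 := by
    exact_mod_cast (Nat.choose_pos (Nat.le_add_right _ _)).ne'
  have h4 : ((i : ℕ)! : ℝ) ≠ 0 := by positivity
  have h5 : ((j : ℕ)! : ℝ) ≠ 0 := by positivity
  field_simp

/-- Cramer's rule. This quotient is the `w̃` of the theorem, and it compares the weights of sets of
sizes `l` and `l + 1` when `p = 2 * l`. -/
theorem wronskianMatrix_inv_last :
    (wronskianMatrix f (l + 1))⁻¹ (Fin.last l) (Fin.last l) =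
      (wronskianMatrix f l).det / (wronskianMatrix f (l + 1)).det := by
  rw [Matrix.inv_def, Matrix.smul_apply, Matrix.adjugate_fin_succ_eq_det_submatrix,
    Ring.inverse_eq_inv', smul_eq_mul, (Even.add_self _).neg_one_pow, one_mul, Fin.succAbove_last,
    div_eq_inv_mul]
  rfl

end Wronskian

/-! ### Exponents -/

/-- Half the order, in powers of `√ε`, of the weights of the sets of `m` points. -/
def weightExp (c p m : ℕ) : ℤ := ∑ a ∈ Finset.range m, ((growthExp c a : ℤ) - p)

section Exponents

variable {c p m m' : ℕ}

theorem weightExp_eq_add (h : m ≤ m') :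
    weightExp c p m' = weightExp c p m + ∑ a ∈ Finset.Ico m m', ((growthExp c a : ℤ) - p) := by
  rw [weightExp, weightExp, Finset.range_eq_Ico, Finset.range_eq_Ico,
    Finset.sum_Ico_consecutive _ (Nat.zero_le m) h]

theorem weightExp_lt_of_lt (h : m < m') (he : ∀ a < m', growthExp c a < p) :
    weightExp c p m' < weightExp c p m := by
  rw [weightExp_eq_add h.le]
  have := Finset.sum_neg (s := Finset.Ico m m') (f := fun a => ((growthExp c a : ℤ) - p))
    (fun a ha => by have := he a (Finset.mem_Ico.1 ha).2; omega) (Finset.nonempty_Ico.2 h)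
  linarith

theorem weightExp_lt_of_gt {a : ℕ} (hma : m ≤ a) (ham : a < m') (ha : p < growthExp c a)
    (he : ∀ a, m ≤ a → p ≤ growthExp c a) : weightExp c p m < weightExp c p m' := by
  rw [weightExp_eq_add (hma.trans ham.le)]
  have := Finset.sum_pos' (s := Finset.Ico m m') (f := fun a => ((growthExp c a : ℤ) - p))
    (fun a ha => by have := he a (Finset.mem_Ico.1 ha).1; omega)
    ⟨a, Finset.mem_Ico.2 ⟨hma, ham⟩, by omega⟩
  linarith

theorem weightExp_eq_of_eq (h : m ≤ m') (he : ∀ a, m ≤ a → a < m' → growthExp c a = p) :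
    weightExp c p m' = weightExp c p m := by
  rw [weightExp_eq_add h, Finset.sum_eq_zero, add_zero]
  intro a ha
  rw [he a (Finset.mem_Ico.1 ha).1 (Finset.mem_Ico.1 ha).2, sub_self]

end Exponents

/-! ### Convergence of the laws -/

section Laws

variable {n : ℕ} {x : Fin n → ℝ} {f : ℝ → ℝ} {c p : ℕ} {α : ℝ}

/-- The limit of the weight of `X`, suitably rescaled. -/
noncomputable def limitWeight (f : ℝ → ℝ) (c : ℕ) (α : ℝ) (x : Fin n → ℝ) (X : Finset (Fin n)) :
    ℝ :=
  α ^ X.card * ((Matrix.vandermonde (points x X rfl)).det ^ 2 *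
    (limitMatrix f c (points x X rfl)).det)

theorem limitWeight_eq {m : ℕ} {X : Finset (Fin n)} (h : X.card = m) :
    limitWeight f c α x X = α ^ m * ((Matrix.vandermonde (points x X h)).det ^ 2 *
      (limitMatrix f c (points x X h)).det) := by
  subst h; rfl

theorem tendsto_weight (hf : AnalyticAt ℝ f 0) (hc : 1 ≤ c)
    (hodd : ∀ k, 1 ≤ k → k < c → taylorCoeff f (2 * k - 1) = 0) (hx : Function.Injective x)
    {m₀ : ℕ} (X : Finset (Fin n)) (h : weightExp c p m₀ ≤ weightExp c p X.card) :
    Tendsto (fun t : ℝ => t ^ (-2 * weightExp c p m₀) *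
        (restrict ((α * (t ^ 2) ^ (-(p : ℤ))) • kernelMatrix f x (t ^ 2)) X).det) (𝓝[>] 0)
      (𝓝 (if weightExp c p X.card = weightExp c p m₀ then limitWeight f c α x X else 0)) := by
  -- `d` is the excess of the exponent of `X` over the minimal one; a factor `t ^ (2 * d)` remains
  -- and kills the limit unless `d = 0`.
  obtain ⟨d, hd⟩ := Int.eq_ofNat_of_zero_le (sub_nonneg.2 h)
  have h1 := ((tendsto_det_kernelMatrix hf hc hodd (points_injective X rfl hx)).const_mul
    (α ^ X.card)).mul (tendsto_pow_div_pow (Nat.zero_le (2 * d)))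
  have h2 : (α ^ X.card * ((Matrix.vandermonde (points x X rfl)).det ^ 2 *
      (limitMatrix f c (points x X rfl)).det)) * (if 2 * d = 0 then 1 else 0) =
      if weightExp c p X.card = weightExp c p m₀ then limitWeight f c α x X else 0 := by
    by_cases hd0 : d = 0
    · rw [if_pos (by omega), if_pos (by omega), mul_one]; rfl
    · rw [if_neg (by omega), if_neg (by omega), mul_zero]
  rw [h2] at h1
  refine h1.congr' ?_
  filter_upwards [self_mem_nhdsWithin] with t ht
  have ht0 : t ≠ 0 := ne_of_gt ht
  have hexp : weightExp c p X.card =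
      (∑ a ∈ Finset.range X.card, growthExp c a : ℕ) - (X.card * p : ℕ) := by
    simp [weightExp, Finset.sum_sub_distrib]
  have h3 : t ^ (-2 * weightExp c p m₀) = t ^ (2 * d) * t ^ (2 * (X.card * p)) /
      t ^ (2 * ∑ a ∈ Finset.range X.card, growthExp c a) := by
    rw [eq_div_iff (pow_ne_zero _ ht0), ← pow_add, ← zpow_natCast, ← zpow_natCast,
      ← zpow_add₀ ht0]
    congr 1
    push_cast at hexp ⊢
    linarith
  have h4 : (restrict ((α * (t ^ 2) ^ (-(p : ℤ))) • kernelMatrix f x (t ^ 2)) X).det =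
      (α * (t ^ 2) ^ (-(p : ℤ))) ^ X.card * (kernelMatrix f (points x X rfl) (t ^ 2)).det := by
    rw [det_restrict X rfl, Matrix.submatrix_smul, Pi.smul_apply, Pi.smul_apply, Matrix.det_smul,
      Fintype.card_fin]
    rfl
  have h5 : (t ^ 2) ^ (-(p : ℤ)) = (t ^ (2 * p))⁻¹ := by
    rw [zpow_neg, zpow_natCast, ← pow_mul]
  have h6 : t ^ (2 * (X.card * p)) = (t ^ (2 * p)) ^ X.card := by
    rw [← pow_mul]; congr 1; ring
  have h7 : t ^ (2 * p) ≠ 0 := pow_ne_zero _ ht0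
  have h8 : t ^ (2 * ∑ a ∈ Finset.range X.card, growthExp c a) ≠ 0 := pow_ne_zero _ ht0
  rw [h3, h4, h5, h6, pow_zero, mul_pow, inv_pow]
  field_simp

variable (hf : AnalyticAt ℝ f 0) (hpd : IsPosDefKernel (stationaryKernel f)) (hc : 1 ≤ c)
  (hodd : ∀ k, 1 ≤ k → k < c → taylorCoeff f (2 * k - 1) = 0)
  (hW : (wronskianMatrix f c).PosDef) (hx : Function.Injective x) (hα : 0 < α)

include hf hpd hc hodd hW hx hα

theorem limitWeight_nonneg (X : Finset (Fin n)) : 0 ≤ limitWeight f c α x X :=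
  mul_nonneg (by positivity) (mul_nonneg (by positivity)
    (det_limitMatrix_nonneg hf hpd hc hodd hW (points_injective X rfl hx)))

theorem limitWeight_pos {X : Finset (Fin n)} (hX : X.card ≤ c ∨ taylorCoeff f (2 * c - 1) ≠ 0) :
    0 < limitWeight f c α x X := by
  have h1 : 0 < (Matrix.vandermonde (points x X rfl)).det ^ 2 :=
    sq_pos_of_ne_zero (Matrix.det_vandermonde_ne_zero_iff.2 (points_injective X rfl hx))
  have h2 := det_limitMatrix_pos hf hpd hc hodd hW hX (points_injective X rfl hx)
  exact mul_pos (by positivity) (mul_pos h1 h2)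

/-- The common power of `t` and the constant `C` cancel in the quotient. The limiting normalisation
is nonzero because all limit weights are nonnegative and those of sets of size `m₀` are positive. -/
theorem convergesTo_rescaledLaw {m₀ : ℕ} (hm₀ : m₀ ≤ n)
    (hm₀c : m₀ ≤ c ∨ taylorCoeff f (2 * c - 1) ≠ 0)
    (hmin : ∀ m ≤ n, weightExp c p m₀ ≤ weightExp c p m) {C : ℝ} (hC : C ≠ 0)
    {w : Finset (Fin n) → ℝ}
    (hw : ∀ X, (if weightExp c p X.card = weightExp c p m₀ then limitWeight f c α x X else 0) =
      C * w X) :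
    ConvergesTo (rescaledLaw f x α p) fun X => w X / ∑ Y, w Y := by
  have hlim : ∀ X : Finset (Fin n), Tendsto (fun t : ℝ => t ^ (-2 * weightExp c p m₀) *
      (restrict ((α * (t ^ 2) ^ (-(p : ℤ))) • kernelMatrix f x (t ^ 2)) X).det) (𝓝[>] 0)
      (𝓝 (C * w X)) := fun X => by
    rw [← hw X]
    exact tendsto_weight hf hc hodd hx X (hmin _ (by simpa using X.card_le_univ))
  have hpos : 0 < ∑ Y, C * w Y := by
    obtain ⟨X, -, hX⟩ := Finset.exists_subset_card_eq (s := (Finset.univ : Finset (Fin n)))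
      (n := m₀) (by simpa using hm₀)
    refine Finset.sum_pos' (fun Y _ => ?_) ⟨X, Finset.mem_univ X, ?_⟩
    · rw [← hw Y]
      split_ifs
      · exact limitWeight_nonneg hf hpd hc hodd hW hx hα Y
      · exact le_rfl
    · rw [← hw X, if_pos (by rw [hX])]
      exact limitWeight_pos hf hpd hc hodd hW hx hα (by rwa [hX])
  intro X
  have h1 : Tendsto (fun t : ℝ => rescaledLaw f x α p (t ^ 2) X) (𝓝[>] 0)
      (𝓝 (w X / ∑ Y, w Y)) := by
    have h2 := (hlim X).div (tendsto_finsetSum Finset.univ fun Y _ => hlim Y) hpos.ne'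
    rw [← Finset.mul_sum, mul_div_mul_left _ _ hC] at h2
    refine h2.congr' ?_
    filter_upwards [self_mem_nhdsWithin] with t ht
    have ht0 : t ≠ 0 := ne_of_gt ht
    rw [Pi.div_apply, ← Finset.mul_sum, mul_div_mul_left _ _ (zpow_ne_zero _ ht0)]
    rfl
  -- Back from `t` to `ε = t ^ 2`.
  have hsqrt : Tendsto Real.sqrt (𝓝[>] 0) (𝓝[>] 0) := by
    refine tendsto_nhdsWithin_iff.2 ⟨?_, ?_⟩
    · have := (Real.continuous_sqrt.tendsto 0).mono_left (nhdsWithin_le_nhds (s := Set.Ioi 0))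
      rwa [Real.sqrt_zero] at this
    · filter_upwards [self_mem_nhdsWithin] with ε hε
      exact Real.sqrt_pos.2 hε
  refine (h1.comp hsqrt).congr' ?_
  filter_upwards [self_mem_nhdsWithin] with ε hε
  rw [Function.comp_apply, Real.sq_sqrt (le_of_lt hε)]

theorem convergesTo_wholeSet (he : ∀ a < n, growthExp c a < p)
    (hnc : n ≤ c ∨ taylorCoeff f (2 * c - 1) ≠ 0) :
    ConvergesTo (rescaledLaw f x α p) wholeSet := by
  have h := convergesTo_rescaledLaw hf hpd hc hodd hW hx hα (p := p) le_rfl hnc (fun m hm => by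
    rcases hm.eq_or_lt with rfl | hm
    · exact le_rfl
    · exact (weightExp_lt_of_lt hm he).le)
    (limitWeight_pos hf hpd hc hodd hW hx hα (X := Finset.univ) (by simpa using hnc)).ne'
    (w := wholeSet) (fun X => by
      by_cases hX : X = Finset.univ
      · subst hX
        simp [wholeSet]
      · have hcard : X.card < n := by
          simpa using Finset.card_lt_univ_of_notMem (not_forall.1 fun h =>
            hX (Finset.eq_univ_iff_forall.2 h)).choose_spec
        rw [if_neg (weightExp_lt_of_lt hcard he).ne', wholeSet, if_neg hX, mul_zero])
  have hsum : ∑ Y : Finset (Fin n), wholeSet Y = 1 := by simp [wholeSet]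
  simpa only [hsum, div_one] using h

/-- Here `growthExp` jumps over `p = 2 * l - 1`, from `2 * l - 2` to `2 * l`, so `l` is the only
minimising size. On it the Wronskian factor is common to all sets and cancels. -/
theorem convergesTo_fixedSizeLEnsemble {l : ℕ} (hp : p + 1 = 2 * l) (hln : l ≤ n)
    (hlc : l < c) :
    ConvergesTo (rescaledLaw f x α p)
      (fixedSizeLEnsemble l (vanderLT x l * (vanderLT x l)ᵀ)) := by
  have he : ∀ a < l, growthExp c a < p := fun a ha => by simp only [growthExp]; omega
  have he' : ∀ a, l ≤ a → p < growthExp c a := fun a ha => by simp only [growthExp]; omega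
  have hlt : ∀ m, m ≠ l → weightExp c p l < weightExp c p m := fun m hm => by
    rcases lt_or_gt_of_ne hm with h | h
    · exact weightExp_lt_of_lt h he
    · exact weightExp_lt_of_gt le_rfl h (he' l le_rfl) fun a ha => (he' a ha).le
  have hdet := (posDef_wronskianMatrix_of_le hW hlc.le).det_pos
  have h := convergesTo_rescaledLaw hf hpd hc hodd hW hx hα (p := p) hln (Or.inl hlc.le)
    (fun m _ => by
      by_cases hm : m = l
      · rw [hm]
      · exact (hlt m hm).le)
    (C := α ^ l * (wronskianMatrix f l).det) (by positivity)
    (w := fun X => if X.card = l then (restrict (vanderLT x l * (vanderLT x l)ᵀ) X).det else 0)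
    (fun X => by
      by_cases hX : X.card = l
      · have hsub : (vanderLT x l * (vanderLT x l)ᵀ).submatrix (X.orderEmbOfFin hX)
            (X.orderEmbOfFin hX) = Matrix.vandermonde (points x X hX) *
              (Matrix.vandermonde (points x X hX))ᵀ := rfl
        rw [if_pos (by rw [hX]), if_pos hX, limitWeight_eq hX, det_limitMatrix_of_le hlc.le,
          det_restrict X hX, hsub, Matrix.det_mul, Matrix.det_transpose]
        ring
      · rw [if_neg (hlt _ hX).ne', if_neg hX, mul_zero])
  intro X
  have hX := h X
  rw [← Finset.sum_filter] at hX
  convert hX using 2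
  simp only [fixedSizeLEnsemble]
  split_ifs <;> simp

end Laws

/-! ### Nonnegative pairs and extended L-ensemble limits -/

section Extended

variable {n : ℕ} {x : Fin n → ℝ}

theorem rank_vanderLT (hx : Function.Injective x) {q : ℕ} (hq : q ≤ n) :
    (vanderLT x q).rank = q := by
  have h1 : IsUnit (Matrix.vandermonde x) := (Matrix.isUnit_iff_isUnit_det _).2
    (isUnit_iff_ne_zero.2 (Matrix.det_vandermonde_ne_zero_iff.2 hx))
  have h2 := (Matrix.linearIndependent_cols_of_isUnit h1).comp _ (Fin.castLE_injective hq)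
  have h3 : LinearIndependent ℝ (vanderLT x q)ᵀ.row := h2
  rw [← Matrix.rank_transpose, h3.rank_matrix, Fintype.card_fin]

theorem sum_mul_pow_eq_zero_of_mulVec {q : ℕ} {u : Fin n → ℝ} (h : (vanderLT x q)ᵀ *ᵥ u = 0)
    (j : ℕ) (hj : j < q) : ∑ i, u i * x i ^ j = 0 := by
  have h1 := congrFun h ⟨j, hj⟩
  simp only [Matrix.mulVec, dotProduct, Matrix.transpose_apply, vanderLT, Matrix.of_apply,
    Pi.zero_apply] at h1
  rw [← h1]
  exact Finset.sum_congr rfl fun i _ => mul_comm _ _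

theorem isNonnegPair_vecMulVec (hx : Function.Injective x) {l : ℕ} (hl : l ≤ n) {r : ℝ}
    (hr : 0 ≤ r) :
    IsNonnegPair (r • Matrix.vecMulVec (vanderCol x l) (vanderCol x l)) (vanderLT x l) where
  symm := by
    ext i j
    simp [Matrix.vecMulVec_apply, mul_comm]
  cpsd u _ := by
    have h : u ⬝ᵥ ((r • Matrix.vecMulVec (vanderCol x l) (vanderCol x l)) *ᵥ u) =
        r * (u ⬝ᵥ vanderCol x l) ^ 2 := by
      rw [Matrix.smul_mulVec, dotProduct_smul, Matrix.vecMulVec_mulVec, dotProduct_comm _ u]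
      simp only [op_smul_eq_smul, dotProduct_smul, smul_eq_mul]
      ring
    rw [h]
    positivity
  fullRank := rank_vanderLT hx hl

theorem dualMatrix_vecMulVec {m : ℕ} {y : Fin m → ℝ} (hy : Function.Injective y) (r : ℝ)
    (l : Fin m) (a b : Fin m) :
    dualMatrix y (r • Matrix.vecMulVec (vanderCol y l) (vanderCol y l)) a b =
      r * ((if a = l then 1 else 0) * if b = l then 1 else 0) := by
  rw [dualMatrix_apply, ← sum_vandermonde_inv_mul_pow hy a l, ← sum_vandermonde_inv_mul_pow hy b l,
    Finset.sum_mul_sum, Finset.mul_sum]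
  refine Finset.sum_congr rfl fun i _ => ?_
  rw [Finset.mul_sum]
  refine Finset.sum_congr rfl fun j _ => ?_
  simp only [Matrix.smul_apply, Matrix.vecMulVec_apply, vanderCol, smul_eq_mul]
  ring

/-- In the dual basis the rank one matrix has a single possibly nonzero entry, at `(l, l)`. The
block is thus empty, the scalar `r`, or has a zero row, according to `k`. -/
theorem extendedWeight_vecMulVec (hx : Function.Injective x) {l k : ℕ} (r : ℝ)
    {X : Finset (Fin n)} (hX : X.card = l + k) :
    extendedWeight (r • Matrix.vecMulVec (vanderCol x l) (vanderCol x l)) (vanderLT x l) X =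
      (Matrix.vandermonde (points x X hX)).det ^ 2 *
        if k = 0 then 1 else if k = 1 then r else 0 := by
  rw [extendedWeight_vanderLT_add hx hX]
  have hsub : (r • Matrix.vecMulVec (vanderCol x l) (vanderCol x l)).submatrix
      (X.orderEmbOfFin hX) (X.orderEmbOfFin hX) =
      r • Matrix.vecMulVec (vanderCol (points x X hX) l) (vanderCol (points x X hX) l) := rfl
  rw [hsub]
  congr 1
  have hy := points_injective X hX hx
  rcases k with _ | _ | k
  · simp
  · have := dualMatrix_vecMulVec hy r ⟨l, by omega⟩ ⟨l, by omega⟩ ⟨l, by omega⟩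
    simp only [if_true, mul_one] at this
    rw [Matrix.det_fin_one]
    exact this
  · rw [if_neg (by omega), if_neg (by omega)]
    refine Matrix.det_eq_zero_of_row_eq_zero (Fin.last (k + 1)) fun j => ?_
    rw [dualBlock, Matrix.submatrix_apply]
    have := dualMatrix_vecMulVec hy r ⟨l, by omega⟩ (Fin.natAdd l (Fin.last (k + 1)))
      (Fin.natAdd l j)
    rw [if_neg (by simp [Fin.ext_iff]), zero_mul, mul_zero] at this
    exact this

variable {f : ℝ → ℝ} {c p : ℕ} {α : ℝ}
  (hf : AnalyticAt ℝ f 0) (hpd : IsPosDefKernel (stationaryKernel f)) (hc : 1 ≤ c)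
  (hodd : ∀ k, 1 ≤ k → k < c → taylorCoeff f (2 * k - 1) = 0)
  (hx : Function.Injective x) (hα : 0 < α)

include hf hpd hc hodd hx hα

theorem isNonnegPair_distMatrix (hcn : c ≤ n) :
    IsNonnegPair ((α * taylorCoeff f (2 * c - 1)) • distMatrix x (2 * c - 1)) (vanderLT x c) where
  symm := (isSymm_distMatrix _ _).smul _
  cpsd u hu := by
    have h := taylorCoeff_mul_sum_sum_dist_nonneg hf hpd hc hodd (sum_mul_pow_eq_zero_of_mulVec hu)
    refine (mul_nonneg hα.le h).trans_eq ?_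
    simp only [dotProduct, Matrix.mulVec, Finset.mul_sum, Matrix.smul_apply, distMatrix,
      Matrix.of_apply, smul_eq_mul]
    exact Finset.sum_congr rfl fun i _ => Finset.sum_congr rfl fun j _ => by ring
  fullRank := rank_vanderLT hx hcn

variable (hW : (wronskianMatrix f c).PosDef)

include hW

/-- Since `growthExp c l = p`, the sizes `l` and `l + 1` tie. Apart from the squared Vandermonde
determinants, their weights are in the ratio `α * det W_{≤ l} / det W_{≤ l-1}`, which is the
coefficient of the rank one matrix. -/
theorem convergesTo_extendedLEnsemble_vecMulVec {l : ℕ} (hp : p = 2 * l) (hln : l ≤ n)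
    (hlc : l < c) :
    ConvergesTo (rescaledLaw f x α p) (extendedLEnsemble
      ((α / ((wronskianMatrix f l).det / (wronskianMatrix f (l + 1)).det)) •
        Matrix.vecMulVec (vanderCol x l) (vanderCol x l)) (vanderLT x l)) := by
  have he : ∀ a < l, growthExp c a < p := fun a ha => by simp only [growthExp]; omega
  have hel : growthExp c l = p := by simp only [growthExp]; omega
  have he' : ∀ a, l + 1 ≤ a → p < growthExp c a := fun a ha => by simp only [growthExp]; omega
  have hge : ∀ a, l ≤ a → p ≤ growthExp c a := fun a ha => by simp only [growthExp]; omega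
  have hlt₁ : ∀ m < l, weightExp c p l < weightExp c p m := fun m h => weightExp_lt_of_lt h he
  have hlt₂ : ∀ m, l + 1 < m → weightExp c p l < weightExp c p m := fun m h =>
    weightExp_lt_of_gt (Nat.le_succ l) h (he' _ le_rfl) hge
  have heq : weightExp c p (l + 1) = weightExp c p l :=
    weightExp_eq_of_eq (Nat.le_succ l) fun a h1 h2 => by
      rw [show a = l by omega, hel]
  have hdet := (posDef_wronskianMatrix_of_le hW hlc.le).det_pos
  have hdet' := (posDef_wronskianMatrix_of_le hW (Nat.succ_le_of_lt hlc)).det_pos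
  refine convergesTo_rescaledLaw hf hpd hc hodd hW hx hα (p := p) hln (Or.inl hlc.le)
    (fun m _ => ?_) (C := α ^ l * (wronskianMatrix f l).det) (by positivity)
    (w := extendedWeight _ _) (fun X => ?_)
  · rcases lt_or_ge m l with h | h
    · exact (hlt₁ m h).le
    · rcases Nat.lt_or_ge (l + 1) m with h' | h'
      · exact (hlt₂ m h').le
      · rcases (show m = l ∨ m = l + 1 by omega) with rfl | rfl
        · exact le_rfl
        · exact heq.ge
  · rcases lt_or_ge X.card l with h | h
    · rw [if_neg (hlt₁ _ h).ne', extendedWeight_vanderLT_of_lt x X h, mul_zero]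
    · obtain ⟨k, hk⟩ := Nat.exists_eq_add_of_le h
      rw [extendedWeight_vecMulVec hx _ hk]
      rcases k with _ | _ | k
      · rw [if_pos (by rw [hk, add_zero]), limitWeight_eq hk,
          det_limitMatrix_of_le (by simpa using hlc.le)]
        simp only [if_true]
        change α ^ l * (_ * (wronskianMatrix f l).det) = _
        ring
      · rw [if_pos (by rw [hk, ← heq]), limitWeight_eq hk,
          det_limitMatrix_of_le (by simpa using hlc)]
        simp only [zero_add, one_ne_zero, if_false, if_true]
        field_simp
        ring
      · rw [if_neg (hlt₂ _ (by omega)).ne', if_neg (by omega), if_neg (by omega), mul_zero,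
          mul_zero]

/-- For every `a ≥ c`, `growthExp c a = 2 * c - 1 = p`, so all sizes from `c` on tie. Of the factor
`α ^ (c + k)`, the part `α ^ c` is a common constant and `α ^ k` is absorbed into the distance
block. -/
theorem convergesTo_extendedLEnsemble_distMatrix (hp : 2 * c = p + 1) (hcn : c ≤ n) :
    ConvergesTo (rescaledLaw f x α p) (extendedLEnsemble
      ((α * taylorCoeff f (2 * c - 1)) • distMatrix x (2 * c - 1)) (vanderLT x c)) := by
  have he : ∀ a < c, growthExp c a < p := fun a ha => by simp only [growthExp]; omega
  have heq : ∀ m, c ≤ m → weightExp c p m = weightExp c p c := fun m h =>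
    weightExp_eq_of_eq h fun a h1 _ => by simp only [growthExp]; omega
  have hlt : ∀ m < c, weightExp c p c < weightExp c p m := fun m h => weightExp_lt_of_lt h he
  have hdet := hW.det_pos
  refine convergesTo_rescaledLaw hf hpd hc hodd hW hx hα (p := p) hcn (Or.inl le_rfl)
    (fun m _ => ?_) (C := α ^ c * (wronskianMatrix f c).det) (by positivity)
    (w := extendedWeight _ _) (fun X => ?_)
  · rcases lt_or_ge m c with h | h
    · exact (hlt m h).le
    · exact (heq m h).ge
  · rcases lt_or_ge X.card c with h | h
    · rw [if_neg (hlt _ h).ne', extendedWeight_vanderLT_of_lt x X h, mul_zero]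
    · obtain ⟨k, hk⟩ := Nat.exists_eq_add_of_le h
      have hsub : ((α * taylorCoeff f (2 * c - 1)) • distMatrix x (2 * c - 1)).submatrix
          (X.orderEmbOfFin hk) (X.orderEmbOfFin hk) =
          α • (taylorCoeff f (2 * c - 1) • distMatrix (points x X hk) (2 * c - 1)) := by
        rw [smul_smul]; rfl
      have hblock : ∀ A, dualBlock c k (points x X hk) (α • A) =
          α • dualBlock c k (points x X hk) A := fun A => by
        ext i j
        simp [dualBlock, dualMatrix]
      rw [if_pos (heq _ h), limitWeight_eq hk, det_limitMatrix_add,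
        extendedWeight_vanderLT_add hx hk, hsub, hblock, Matrix.det_smul, Fintype.card_fin, pow_add]
      ring

end Extended

/-! ### The smoothness order -/

/-- An infinite smoothness order is replaced by an integer exceeding all exponents in play, so that
both situations share the same asymptotics. -/
theorem exists_order (f : ℝ → ℝ) (N : ℕ) : ∃ c : ℕ, 1 ≤ c ∧
    (∀ k, 1 ≤ k → k < c → taylorCoeff f (2 * k - 1) = 0) ∧
    ((smoothnessOrder f = c ∧ taylorCoeff f (2 * c - 1) ≠ 0) ∨
      (smoothnessOrder f = ⊤ ∧ N ≤ c ∧ ∀ k, 1 ≤ k → taylorCoeff f (2 * k - 1) = 0)) := by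
  classical
  by_cases h : ∃ k, 1 ≤ k ∧ taylorCoeff f (2 * k - 1) ≠ 0
  · obtain ⟨h1, h2⟩ := Nat.find_spec h
    refine ⟨Nat.find h, h1, fun k hk hkc => ?_, Or.inl ⟨le_antisymm ?_ ?_, h2⟩⟩
    · by_contra h0
      exact Nat.find_min h hkc ⟨hk, h0⟩
    · exact iInf₂_le (Nat.find h) ⟨h1, h2⟩
    · exact le_iInf₂ fun k hk => by exact_mod_cast Nat.find_min' h hk
  · have h0 : ∀ k, 1 ≤ k → taylorCoeff f (2 * k - 1) = 0 := fun k hk => by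
      by_contra h1
      exact h ⟨k, hk, h1⟩
    refine ⟨N + 1, by omega, fun k hk _ => h0 k hk, Or.inr ⟨?_, Nat.le_succ N, h0⟩⟩
    exact iInf₂_eq_top.2 fun k hk => absurd (h0 k hk.1) hk.2

end FlatLimit

theorem mainTheorem11 (n : ℕ) (x : Fin n → ℝ) (hx : Function.Injective x)
    (p : ℕ) (α : ℝ) (hα : 0 < α)
    (f : ℝ → ℝ) (hf : AnalyticAt ℝ f 0)
    (hpd : FlatLimit.IsPosDefKernel (FlatLimit.stationaryKernel f))
    (r : ℕ∞) (hr : FlatLimit.smoothnessOrder f = r)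
    (hstrict : r = ⊤ → FlatLimit.IsStrictPosDefKernel (FlatLimit.stationaryKernel f)) :
    (2 * n ≤ p + 1 →
      FlatLimit.ConvergesTo (FlatLimit.rescaledLaw f x α p) FlatLimit.wholeSet) ∧
    (p + 1 ≤ 2 * n →
      (2 * r < (p : ℕ∞) + 1 →
        FlatLimit.ConvergesTo (FlatLimit.rescaledLaw f x α p) FlatLimit.wholeSet) ∧
      ((p : ℕ∞) + 1 < 2 * r →
        (∀ l : ℕ, p + 1 = 2 * l →
          FlatLimit.ConvergesTo (FlatLimit.rescaledLaw f x α p)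
            (FlatLimit.fixedSizeLEnsemble l
              (FlatLimit.vanderLT x l * (FlatLimit.vanderLT x l)ᵀ))) ∧
        (∀ l : ℕ, p = 2 * l → ∀ w : ℝ,
          w = (FlatLimit.wronskian (FlatLimit.stationaryKernel f) l)⁻¹ (Fin.last l) (Fin.last l) →
          IsUnit (FlatLimit.wronskian (FlatLimit.stationaryKernel f) l).det ∧ 0 < w ∧
          FlatLimit.IsNonnegPair
            ((α / w) • Matrix.vecMulVec (FlatLimit.vanderCol x l) (FlatLimit.vanderCol x l))
            (FlatLimit.vanderLT x l) ∧
          FlatLimit.ConvergesTo (FlatLimit.rescaledLaw f x α p)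
            (FlatLimit.extendedLEnsemble
              ((α / w) • Matrix.vecMulVec (FlatLimit.vanderCol x l) (FlatLimit.vanderCol x l))
              (FlatLimit.vanderLT x l)))) ∧
      (∀ s : ℕ, r = (s : ℕ∞) → 2 * s = p + 1 →
        FlatLimit.IsNonnegPair
          ((α * FlatLimit.taylorCoeff f (2 * s - 1)) • FlatLimit.distMatrix x (2 * s - 1))
          (FlatLimit.vanderLT x s) ∧
        FlatLimit.ConvergesTo (FlatLimit.rescaledLaw f x α p)
          (FlatLimit.extendedLEnsemble
            ((α * FlatLimit.taylorCoeff f (2 * s - 1)) • FlatLimit.distMatrix x (2 * s - 1))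
            (FlatLimit.vanderLT x s)))) := by
  -- When the order is infinite, this choice ensures `n ≤ c` and `p + 1 < 2 * c`.
  obtain ⟨c, hc, hodd, hord⟩ := FlatLimit.exists_order f (n + p + 1)
  rw [hr] at hord
  have hW : (FlatLimit.wronskianMatrix f c).PosDef :=
    FlatLimit.posDef_wronskianMatrix hf hpd hodd
      (hord.imp (fun h => h.2) fun h => ⟨h.2.2, hstrict h.1⟩)
  have hnc : n ≤ c ∨ FlatLimit.taylorCoeff f (2 * c - 1) ≠ 0 :=
    hord.symm.imp (fun h => by have := h.2.1; omega) fun h => h.2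
  refine ⟨fun hn => ?_, fun hn => ⟨fun hrp => ?_, fun hrp => ?_, fun s hs hsp => ?_⟩⟩
  -- Here `growthExp c a ≤ 2 * a < p` for `a < n`, whatever the order; in the next case the bound
  -- `growthExp c a ≤ 2 * c - 1 < p` serves instead.
  · refine FlatLimit.convergesTo_wholeSet hf hpd hc hodd hW hx hα (fun a ha => ?_) hnc
    simp only [FlatLimit.growthExp]; omega
  · rcases hord with ⟨rfl, hfc⟩ | ⟨rfl, -⟩
    · have hcp : 2 * c < p + 1 := by exact_mod_cast hrp
      refine FlatLimit.convergesTo_wholeSet hf hpd hc hodd hW hx hα (fun a ha => ?_) hnc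
      simp only [FlatLimit.growthExp]; omega
    · simp at hrp
  · have hcp : p + 1 < 2 * c := by
      rcases hord with ⟨rfl, -⟩ | ⟨-, h, -⟩
      · exact_mod_cast hrp
      · omega
    refine ⟨fun l hl => ?_, fun l hl w hw => ?_⟩
    · exact FlatLimit.convergesTo_fixedSizeLEnsemble hf hpd hc hodd hW hx hα hl (by omega)
        (by omega)
    · have hlc : l < c := by omega
      have hdet := (FlatLimit.posDef_wronskianMatrix_of_le hW hlc.le).det_pos
      have hdet' := (FlatLimit.posDef_wronskianMatrix_of_le hW (Nat.succ_le_of_lt hlc)).det_pos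
      rw [FlatLimit.wronskian_eq hf fun k h1 h2 => hodd k h1 (by omega)] at hw ⊢
      rw [FlatLimit.wronskianMatrix_inv_last] at hw
      have hw0 : 0 < w := hw ▸ div_pos hdet hdet'
      refine ⟨isUnit_iff_ne_zero.2 hdet'.ne', hw0,
        FlatLimit.isNonnegPair_vecMulVec hx (by omega) (by positivity), ?_⟩
      rw [hw]
      exact FlatLimit.convergesTo_extendedLEnsemble_vecMulVec hf hpd hc hodd hx hα hW hl (by omega)
        hlc
  · rcases hord with ⟨hrc, -⟩ | ⟨hrt, -⟩
    · have hsc : s = c := by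
        rw [hs] at hrc
        exact_mod_cast hrc
      subst hsc
      exact ⟨FlatLimit.isNonnegPair_distMatrix hf hpd hc hodd hx hα (by omega),
        FlatLimit.convergesTo_extendedLEnsemble_distMatrix hf hpd hc hodd hx hα hW hsp (by omega)⟩
    · rw [hs] at hrt
      exact absurd hrt (ENat.natCast_ne_top s)
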